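/- All spaces are Tychonoff and all maps between them are continuous. A space $X$ is \emph{submetrizable} if it admits a metric that is continuous on $X\times X$. Given an open cover $\mathcal U$ of $X$, maps $f,f'\colon K\to X$ are \emph{$\mathcal U$-homotopic} if there is a homotopy $h\colon K\times[0,1]\to X$ between them such that for every $x\in K$ the set $h(\{x\}\times[0,1])$ lies in some $U\in\mathcal U$. Let $m,n,k\in\{0,1,2,\dots\}\cup\{\infty\}$ and $\mathbb I=[0,1]$ ($\mathbb I^\infty$ being the Hilbert cube). $X$ has the \emph{$m$-$\mathrm{HDD}^{n,k}$-property} if for every open cover $\mathcal U$ of $X$ and all maps $f\colon\mathbb I^m\times\mathbb I^n\to X$, $g\colon\mathbb I^m\times\mathbb I^k\to X$ there are maps $f'\colon\mathbb I^m\times\mathbb I^n\to X$, $g'\colon\mathbb I^m\times\mathbb I^k\to X$ such that $f'$ is $\mathcal U$-homotopic to $f$, $g'$ is $\mathcal U$-homotopic to $g$, and $f'(\{z\}\times\mathbb I^n)\cap g'(\{z\}\times\mathbb I^k)=\varnothing$ for all $z\in\mathbb I^m$. Simplicial complexes are geometric realizations of abstract simplicial complexes; a map between simplicial complexes is \emph{simplicial}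 if it maps each simplex of the source linearly onto some simplex of the target. For a simplicial map $p$ between finite complexes, $\dim(p)\le n$ means that every fiber $p^{-1}(z)$ (a polyhedron) has dimension at most $n$. \textbf{Theorem.} A submetrizable space $X$ has the $m$-$\mathrm{HDD}^{n,k}$-property if and only if for any \begin{itemize} \item simplicial maps $p_N\colon N\to M$ and $p_K\colon K\to M$ between finite simplicial complexes with $\dim M\le m$, $\dim(p_N)\le n$, $\dim(p_K)\le k$, \item open cover $\mathcal U$ of $X$, and \item maps $f\colon N\to X$ and $g\colon K\to X$, \end{itemize} there exist maps $f'\colon N\to X$ and $g'\colon K\to X$ such that $f'$ is $\mathcal U$-homotopic to $f$, $g'$ is $\mathcal U$-homotopic to $g$, and $f'(p_N^{-1}(z))\cap g'(p_K^{-1}(z))=\varnothing$ for every $z\in M$. -/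

import Mathlib

open Set

/-- `X` admits a continuous metric, i.e. a metric (in general inducing a coarser topology) which is
continuous on `X × X` for the given topology of `X`. -/
def Submetrizable (X : Type*) [TopologicalSpace X] : Prop :=
  ∃ d : X → X → ℝ,
    (∀ x y, d x y = 0 ↔ x = y) ∧
    (∀ x y, d x y = d y x) ∧
    (∀ x y z, d x z ≤ d x y + d y z) ∧
    Continuous (fun q : X × X => d q.1 q.2)

/-- `𝒰` is an open cover of `X`. -/
def IsOpenCovering {X : Type*} [TopologicalSpace X] (𝒰 : Set (Set X)) : Prop :=
  (∀ U ∈ 𝒰, IsOpen U) ∧ ⋃₀ 𝒰 = univ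

/-- Two maps are `𝒰`-homotopic: some homotopy between them moves every point inside a single
element of `𝒰`. -/
def UHomotopic {K X : Type*} [TopologicalSpace K] [TopologicalSpace X]
    (𝒰 : Set (Set X)) (f g : C(K, X)) : Prop :=
  ∃ h : ContinuousMap.Homotopy f g, ∀ x : K, ∃ U ∈ 𝒰, ∀ t : unitInterval, h (t, x) ∈ U

/-- The cube `[0,1]^m` for `m ∈ {0, 1, 2, …, ∞}`; for `m = ⊤` it is the Hilbert cube `[0,1]^ℕ`. -/
abbrev Cube (m : ℕ∞) : Type :=
  {i : ℕ // (i : ℕ∞) < m} → unitInterval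

/-- The `m`-`DD^{n,k}`-property, in its homotopical version. -/
def HasHDD (X : Type*) [TopologicalSpace X] (m n k : ℕ∞) : Prop :=
  ∀ 𝒰 : Set (Set X), IsOpenCovering 𝒰 →
    ∀ (f : C(Cube m × Cube n, X)) (g : C(Cube m × Cube k, X)),
      ∃ (f' : C(Cube m × Cube n, X)) (g' : C(Cube m × Cube k, X)),
        UHomotopic 𝒰 f' f ∧ UHomotopic 𝒰 g' g ∧
        ∀ z : Cube m, Disjoint (f' '' ({z} ×ˢ univ)) (g' '' ({z} ×ˢ univ))

/-- The closed geometric simplex spanned by a finite set `s` of vertices, in barycentric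
coordinates. -/
def closedSimplex {V : Type*} [Fintype V] (s : Finset V) : Set (V → ℝ) :=
  {x | x ∈ stdSimplex ℝ V ∧ ∀ v, v ∉ s → x v = 0}

/-- The geometric realization of a finite abstract simplicial complex. As the complex is finite,
the CW-topology is the topology induced from `V → ℝ`. -/
def realization {V : Type*} [Fintype V] (K : AbstractSimplicialComplex V) : Set (V → ℝ) :=
  ⋃ s ∈ K.faces, closedSimplex s

/-- A simplicial complex has dimension at most `m`: every simplex has at most `m + 1` vertices. -/
def ComplexDimLE {V : Type*} (K : AbstractSimplicialComplex V) (m : ℕ∞) : Prop :=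
  ∀ s ∈ K.faces, (s.card : ℕ∞) ≤ m + 1

/-- A map between realizations is simplicial if it maps every simplex of the source onto some
simplex of the target, and is linear on every simplex. -/
structure IsSimplicialMap {V W : Type*} [Fintype V] [Fintype W]
    {K : AbstractSimplicialComplex V} {M : AbstractSimplicialComplex W}
    (p : realization K → realization M) : Prop where
  maps_onto : ∀ s ∈ K.faces, ∃ t ∈ M.faces,
    (fun x => (p x : W → ℝ)) '' {x | (x : V → ℝ) ∈ closedSimplex s} = closedSimplex t
  linear : ∀ s ∈ K.faces, ∀ x y z : realization K,
    (x : V → ℝ) ∈ closedSimplex s → (y : V → ℝ) ∈ closedSimplex s →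
    ∀ a b : ℝ, 0 ≤ a → 0 ≤ b → a + b = 1 →
    (z : V → ℝ) = a • (x : V → ℝ) + b • (y : V → ℝ) →
    (p z : W → ℝ) = a • (p x : W → ℝ) + b • (p y : W → ℝ)

/-- The dimension of a polyhedron `P` (a finite union of convex hulls of finite sets) is at most
`n`: every nondegenerate geometric simplex contained in `P` has at most `n + 1` vertices. -/
def PolyhedronDimLE {E : Type*} [AddCommGroup E] [Module ℝ E] (P : Set E) (n : ℕ∞) : Prop :=
  ∀ t : Finset E, AffineIndependent ℝ ((↑) : t → E) → convexHull ℝ (t : Set E) ⊆ P →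
    (t.card : ℕ∞) ≤ n + 1

/-- `dim p ≤ n` for a simplicial map `p`: all its fibers, which are polyhedra, have dimension at
most `n`. -/
def MapDimLE {V W : Type*} [Fintype V] [Fintype W]
    {K : AbstractSimplicialComplex V} {M : AbstractSimplicialComplex W}
    (p : realization K → realization M) (n : ℕ∞) : Prop :=
  ∀ z : realization M, PolyhedronDimLE (((↑) : realization K → V → ℝ) '' (p ⁻¹' {z})) n

/-!
The property `HasHDD` is general position for the projections `[0,1]^m × [0,1]^n → [0,1]^m` and
`[0,1]^m × [0,1]^k → [0,1]^m`. These projections and arbitrary simplicial maps with fibres of the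
right dimension can be traded for one another: each kind of map embeds, at least over simplices, into
the other kind by a fibre preserving embedding onto a retract. The retraction need not respect the
fibres. It only serves to extend the given maps, and the separated maps are restricted along the
embedding.

From cubes to complexes: a simplicial map is given by a map of vertices. On a simplex `s` with image
`r`, a point is determined by its image and by its coordinates at the vertices of `s` that are not
needed to cover `r`; there are at most `n` of those (`card_sdiff_le_of_mapDimLE`), so `s` embeds into
`[0,1]^m × [0,1]^n` over an embedding of `r` into `[0,1]^m`, and it is a retract of this product by
the Tietze extension theorem (`exists_retract_cube`). Hence `HasHDD` separates `f` and `g` over any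
pair of simplices with the same image after small deformations on these simplices, which extend to
the whole complexes (`exists_covering_extension`). All pairs of simplices are treated one after the
other. This works because separation over a compact set of pairs is preserved by small homotopies
(`Submetrizable.exists_covering_ne`, where the continuous metric is used), and being `𝒰`-homotopic to
a given map is preserved as well (`UHomotopic.exists_covering_trans`).

From complexes to cubes: by shrinking coordinates, every map of a cube can be deformed slightly to
one that factors through a finite-dimensional cube (`exists_factor_shrink`). The cube `[0,1]^H` is
triangulated by the chains of subsets of `H`: the barycentric coordinate of `x` at `S ⊆ H` is the
length of the set of all `t ∈ [0,1)` with `{i | t < x i} = S`. In this triangulation the projection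
forgetting the coordinates in `J` is simplicial, and its fibres have dimension at most `|J|`
(`card_le_card_image_vertexProjection`, `mapDimLE_simplicialMap`).
-/

open Topology

/-! ### Small homotopies -/

section Homotopies

variable {K L X : Type*} [TopologicalSpace K] [TopologicalSpace L] [TopologicalSpace X]

theorem IsOpenCovering.exists_mem {𝒰 : Set (Set X)} (h : IsOpenCovering 𝒰) (x : X) :
    ∃ U ∈ 𝒰, x ∈ U := by
  have : x ∈ ⋃₀ 𝒰 := h.2 ▸ mem_univ x
  simpa using this

theorem IsOpenCovering.inter {𝒰 𝒱 : Set (Set X)} (hU : IsOpenCovering 𝒰)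
    (hV : IsOpenCovering 𝒱) : IsOpenCovering (image2 (· ∩ ·) 𝒰 𝒱) := by
  constructor
  · rintro _ ⟨U, h1, V, h2, rfl⟩
    exact (hU.1 U h1).inter (hV.1 V h2)
  · refine eq_univ_of_forall fun x => ?_
    obtain ⟨U, h1, hx1⟩ := hU.exists_mem x
    obtain ⟨V, h2, hx2⟩ := hV.exists_mem x
    exact ⟨U ∩ V, ⟨U, h1, V, h2, rfl⟩, hx1, hx2⟩

theorem UHomotopic.refl {𝒰 : Set (Set X)} (h : IsOpenCovering 𝒰) (f : C(K, X)) :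
    UHomotopic 𝒰 f f := by
  refine ⟨ContinuousMap.Homotopy.refl f, fun x => ?_⟩
  obtain ⟨U, hU, hx⟩ := h.exists_mem (f x)
  exact ⟨U, hU, fun t => by simpa using hx⟩

theorem UHomotopic.symm {𝒰 : Set (Set X)} {f g : C(K, X)} (h : UHomotopic 𝒰 f g) :
    UHomotopic 𝒰 g f := by
  obtain ⟨H, hH⟩ := h
  refine ⟨H.symm, fun x => ?_⟩
  obtain ⟨U, hU, hx⟩ := hH x
  exact ⟨U, hU, fun t => by simpa using hx _⟩

theorem UHomotopic.comp_right {𝒰 : Set (Set X)} {f g : C(K, X)} (h : UHomotopic 𝒰 f g)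
    (r : C(L, K)) : UHomotopic 𝒰 (f.comp r) (g.comp r) := by
  obtain ⟨H, hH⟩ := h
  refine ⟨H.comp (ContinuousMap.Homotopy.refl r), fun x => ?_⟩
  obtain ⟨U, hU, hx⟩ := hH (r x)
  exact ⟨U, hU, fun t => by simpa using hx t⟩

theorem UHomotopic.mono {𝒰 𝒱 : Set (Set X)} {f g : C(K, X)} (h : UHomotopic 𝒱 f g)
    (hVU : ∀ V ∈ 𝒱, ∃ U ∈ 𝒰, V ⊆ U) : UHomotopic 𝒰 f g := by
  obtain ⟨H, hH⟩ := h
  refine ⟨H, fun x => ?_⟩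
  obtain ⟨V, hV, hx⟩ := hH x
  obtain ⟨U, hU, hVU⟩ := hVU V hV
  exact ⟨U, hU, fun t => hVU (hx t)⟩

theorem UHomotopic.of_inter_left {𝒰 𝒱 : Set (Set X)} {f g : C(K, X)}
    (h : UHomotopic (image2 (· ∩ ·) 𝒰 𝒱) f g) : UHomotopic 𝒰 f g :=
  h.mono (by rintro _ ⟨U, hU, V, -, rfl⟩; exact ⟨U, hU, inter_subset_left⟩)

theorem UHomotopic.of_inter_right {𝒰 𝒱 : Set (Set X)} {f g : C(K, X)}
    (h : UHomotopic (image2 (· ∩ ·) 𝒰 𝒱) f g) : UHomotopic 𝒱 f g :=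
  h.mono (by rintro _ ⟨U, -, V, hV, rfl⟩; exact ⟨V, hV, inter_subset_right⟩)

/-- Being `𝒰`-homotopic to `f` is an open condition, which makes up for the failure of
transitivity: maps sufficiently close to a `𝒰`-homotopic map are still `𝒰`-homotopic to `f`. -/
theorem UHomotopic.exists_covering_trans [CompactSpace K] [T2Space K] [T2Space X]
    {𝒰 : Set (Set X)} (h𝒰 : IsOpenCovering 𝒰) {f f₁ : C(K, X)} (h : UHomotopic 𝒰 f₁ f) :
    ∃ 𝒱 : Set (Set X), IsOpenCovering 𝒱 ∧
      ∀ f₂ : C(K, X), UHomotopic 𝒱 f₂ f₁ → UHomotopic 𝒰 f₂ f := by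
  obtain ⟨H, hH⟩ := h
  choose U hU hHU using hH
  -- compact neighbourhoods on which all tracks of `H` stay in one element of the cover
  have hnhds : ∀ x : K, ∃ Q ∈ 𝓝 x, IsCompact Q ∧ ∀ y ∈ Q, ∀ t, H (t, y) ∈ U x := by
    intro x
    have hev : ∀ᶠ y in 𝓝 x, ∀ t ∈ (univ : Set unitInterval), H (t, y) ∈ U x := by
      refine isCompact_univ.eventually_forall_of_forall_eventually fun t _ => ?_
      have hc : ContinuousAt (fun z : K × unitInterval => H (z.2, z.1)) (x, t) := by
        exact (H.continuous.comp continuous_swap).continuousAt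
      exact hc.eventually_mem ((h𝒰.1 _ (hU x)).mem_nhds (hHU x t))
    obtain ⟨Q, hQ, hQs, hQc⟩ := local_compact_nhds hev
    exact ⟨Q, hQ, hQc, fun y hy t => hQs hy t (mem_univ t)⟩
  choose Q hQ hQc hQU using hnhds
  obtain ⟨F, -, hF⟩ := isCompact_univ.elim_nhds_subcover Q fun x _ => hQ x
  -- the cover is chosen such that an element that meets `f₁ '' Q i` is contained in `U i`
  let V : X → Set X := fun y => ⋂ i ∈ F,
    {z | (y ∈ f₁ '' Q i → z ∈ U i) ∧ (y ∉ f₁ '' Q i → z ∉ f₁ '' Q i)}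
  have hmemV : ∀ y z, z ∈ V y ↔
      ∀ i ∈ F, (y ∈ f₁ '' Q i → z ∈ U i) ∧ (y ∉ f₁ '' Q i → z ∉ f₁ '' Q i) := by
    intro y z; simp only [V, mem_iInter, mem_ofPred_eq]
  refine ⟨range V, ⟨?_, ?_⟩, ?_⟩
  · rintro _ ⟨y, rfl⟩
    refine isOpen_biInter_finset fun i _ => ?_
    by_cases hy : y ∈ f₁ '' Q i
    · simpa only [hy, true_imp_iff, not_true_eq_false, false_imp_iff, and_true, ofPred_mem_eq]
        using h𝒰.1 _ (hU i)
    · simp only [hy, true_imp_iff, not_false_eq_true, false_imp_iff, true_and]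
      exact ((hQc i).image f₁.continuous).isClosed.isOpen_compl
  · refine eq_univ_of_forall fun y => ⟨V y, ⟨y, rfl⟩, (hmemV y y).2 fun i _ => ⟨?_, fun h => h⟩⟩
    rintro ⟨x, hx, rfl⟩
    simpa using hQU i x hx 0
  · rintro f₂ ⟨G, hG⟩
    refine ⟨G.trans H, fun x => ?_⟩
    obtain ⟨i, hi, hxi⟩ : ∃ i ∈ F, x ∈ Q i := by simpa using hF (mem_univ x)
    obtain ⟨_, ⟨y, rfl⟩, hy⟩ := hG x
    have h1 : f₁ x ∈ V y := by simpa using hy 1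
    have hyi : y ∈ f₁ '' Q i := by
      by_contra hyi
      exact ((hmemV _ _).1 h1 i hi).2 hyi ⟨x, hxi, rfl⟩
    refine ⟨U i, hU i, fun t => ?_⟩
    rw [ContinuousMap.Homotopy.trans_apply]
    split_ifs
    · exact ((hmemV _ _).1 (hy _) i hi).1 hyi
    · exact hQU i x hxi _

/-- Over a compact space the initial parts of the tracks of a homotopy are small. -/
theorem exists_forall_le_mem_covering [CompactSpace K] {𝒰 : Set (Set X)}
    (h𝒰 : IsOpenCovering 𝒰) (F : C(unitInterval × K, X)) :
    ∃ c : unitInterval, 0 < c ∧ ∀ c' ≤ c, ∀ x, ∃ U ∈ 𝒰, ∀ u ≤ c', F (u, x) ∈ U := by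
  suffices h : ∃ c : unitInterval, 0 < c ∧ ∀ x ∈ (univ : Set K), ∃ U ∈ 𝒰, ∀ u ≤ c, F (u, x) ∈ U by
    obtain ⟨c, hc, h⟩ := h
    refine ⟨c, hc, fun c' hc' x => ?_⟩
    obtain ⟨U, hU, h⟩ := h x (mem_univ x)
    exact ⟨U, hU, fun u hu => h u (hu.trans hc')⟩
  refine isCompact_univ.induction_on (p := fun s => ∃ c : unitInterval, 0 < c ∧
    ∀ x ∈ s, ∃ U ∈ 𝒰, ∀ u ≤ c, F (u, x) ∈ U) ?_ ?_ ?_ ?_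
  · exact ⟨1, zero_lt_one, by simp⟩
  · rintro s t hst ⟨c, hc, h⟩
    exact ⟨c, hc, fun x hx => h x (hst hx)⟩
  · rintro s t ⟨c, hc, h⟩ ⟨c', hc', h'⟩
    refine ⟨min c c', lt_min hc hc', ?_⟩
    rintro x (hx | hx)
    · obtain ⟨U, hU, h⟩ := h x hx
      exact ⟨U, hU, fun u hu => h u (hu.trans (min_le_left _ _))⟩
    · obtain ⟨U, hU, h⟩ := h' x hx
      exact ⟨U, hU, fun u hu => h u (hu.trans (min_le_right _ _))⟩
  · intro x _
    obtain ⟨U, hU, hx⟩ := h𝒰.exists_mem (F (0, x))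
    have hev := F.continuous.continuousAt.eventually_mem ((h𝒰.1 U hU).mem_nhds hx)
    rw [nhds_prod_eq] at hev
    obtain ⟨p, hp, q, hq, hpq⟩ := Filter.eventually_prod_iff.1 hev
    obtain ⟨c, hc, hcp⟩ : ∃ c : unitInterval, 0 < c ∧ ∀ u ≤ c, p u := by
      obtain ⟨a, ha, hap⟩ := (nhds_bot_basis (α := unitInterval)).mem_iff.1 hp
      obtain ⟨c, hc, hca⟩ := exists_between ha
      exact ⟨c, hc, fun u hu => hap (lt_of_le_of_lt hu hca)⟩
    exact ⟨{y | q y}, mem_nhdsWithin_of_mem_nhds hq, c, hc,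
      fun y hy => ⟨U, hU, fun u hu => hpq (hcp u hu) hy⟩⟩

theorem UHomotopic.dist_lt {d : X → X → ℝ} (hsymm : ∀ x y, d x y = d y x)
    (htri : ∀ x y z, d x z ≤ d x y + d y z) {ε : ℝ} {f' f : C(K, X)}
    (h : UHomotopic (range fun x => {y | d x y < ε / 4}) f' f) (x : K) :
    d (f x) (f' x) < ε / 2 := by
  obtain ⟨H, hH⟩ := h
  obtain ⟨_, ⟨y, rfl⟩, hy⟩ := hH x
  have h1 : d y (f' x) < ε / 4 := by simpa using hy 0
  have h2 : d y (f x) < ε / 4 := by simpa using hy 1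
  have h3 := htri (f x) y (f' x)
  rw [hsymm (f x) y] at h3
  linarith

/-- In a submetrizable space, maps that never take equal values on a compact set of pairs keep
this property after small homotopies. -/
theorem Submetrizable.exists_covering_ne (hX : Submetrizable X) {Z : Set (K × L)}
    (hZ : IsCompact Z) {f : C(K, X)} {g : C(L, X)} (hfg : ∀ z ∈ Z, f z.1 ≠ g z.2) :
    ∃ 𝒱 : Set (Set X), IsOpenCovering 𝒱 ∧ ∀ (f' : C(K, X)) (g' : C(L, X)),
      UHomotopic 𝒱 f' f → UHomotopic 𝒱 g' g → ∀ z ∈ Z, f' z.1 ≠ g' z.2 := by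
  obtain ⟨d, h0, hsymm, htri, hd⟩ := hX
  have hnn : ∀ x y, 0 ≤ d x y := fun x y => by
    have h1 := htri x y x
    rw [(h0 x x).2 rfl, hsymm y x] at h1
    linarith
  obtain ⟨ε, hε, hεd⟩ : ∃ ε > 0, ∀ z ∈ Z, ε ≤ d (f z.1) (g z.2) := by
    rcases Z.eq_empty_or_nonempty with rfl | hne
    · exact ⟨1, one_pos, by simp⟩
    · have hc : Continuous fun z : K × L => d (f z.1) (g z.2) :=
        hd.comp ((f.continuous.comp continuous_fst).prodMk (g.continuous.comp continuous_snd))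
      obtain ⟨z, hz, hmin⟩ := hZ.exists_isMinOn hne hc.continuousOn
      exact ⟨d (f z.1) (g z.2), lt_of_le_of_ne (hnn _ _)
        fun h => hfg z hz ((h0 _ _).1 h.symm), fun w hw => hmin hw⟩
  refine ⟨range fun x => {y | d x y < ε / 4}, ⟨?_, ?_⟩, ?_⟩
  · rintro _ ⟨x, rfl⟩
    exact isOpen_lt (hd.comp (continuous_const.prodMk continuous_id)) continuous_const
  · refine eq_univ_of_forall fun x => ⟨_, ⟨x, rfl⟩, ?_⟩
    simp only [mem_ofPred_eq, (h0 x x).2 rfl]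
    positivity
  · intro f' g' hf hg z hz heq
    have h1 := hf.dist_lt hsymm htri z.1
    have h2 := hg.dist_lt hsymm htri z.2
    have h3 := htri (f z.1) (f' z.1) (g z.2)
    rw [heq, hsymm (g' z.2)] at h3
    rw [heq] at h1
    linarith [hεd z hz]

end Homotopies

/-! ### Realizations of simplicial complexes -/

section Simplices

variable {V : Type*}

theorem face_nonempty {K : AbstractSimplicialComplex V} {s : Finset V} (hs : s ∈ K.faces) :
    s.Nonempty :=
  (K.isRelLowerSet_faces hs).1

theorem face_of_subset {K : AbstractSimplicialComplex V} {s t : Finset V} (hs : s ∈ K.faces)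
    (hts : t ⊆ s) (ht : t.Nonempty) : t ∈ K.faces :=
  (K.isRelLowerSet_faces hs).2 hts ht

variable [Fintype V]

theorem mem_closedSimplex {s : Finset V} {x : V → ℝ} :
    x ∈ closedSimplex s ↔ (∀ v, 0 ≤ x v) ∧ ∑ v, x v = 1 ∧ ∀ v, v ∉ s → x v = 0 := by
  simp only [closedSimplex, stdSimplex, mem_ofPred_eq, and_assoc]

theorem mem_realization {K : AbstractSimplicialComplex V} {x : V → ℝ} :
    x ∈ realization K ↔ ∃ s ∈ K.faces, x ∈ closedSimplex s := by
  simp [realization]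

theorem closedSimplex_mono {s t : Finset V} (h : s ⊆ t) : closedSimplex s ⊆ closedSimplex t := by
  rintro x ⟨h1, h2⟩
  exact ⟨h1, fun v hv => h2 v fun hs => hv (h hs)⟩

theorem convex_closedSimplex (s : Finset V) : Convex ℝ (closedSimplex s) := by
  intro x hx y hy a b ha hb hab
  rw [mem_closedSimplex] at *
  refine ⟨fun v => ?_, ?_, fun v hv => ?_⟩
  · have := hx.1 v; have := hy.1 v
    simp only [Pi.add_apply, Pi.smul_apply, smul_eq_mul]; positivity
  · simp [Finset.sum_add_distrib, ← Finset.mul_sum, hx.2.1, hy.2.1, hab]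
  · simp [hx.2.2 v hv, hy.2.2 v hv]

theorem isCompact_closedSimplex (s : Finset V) : IsCompact (closedSimplex s) := by
  have : closedSimplex s = stdSimplex ℝ V ∩ ⋂ v, {x | v ∉ s → x v = 0} := by
    ext x; simp [closedSimplex]
  rw [this]
  refine (isCompact_stdSimplex ℝ V).inter_right (isClosed_iInter fun v => ?_)
  by_cases hv : v ∈ s
  · simp [hv]
  · simpa [hv] using isClosed_eq (continuous_apply v) continuous_const

theorem isCompact_realization (K : AbstractSimplicialComplex V) : IsCompact (realization K) :=
  (Set.toFinite K.faces).isCompact_biUnion fun s _ => isCompact_closedSimplex s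

instance (s : Finset V) : CompactSpace (closedSimplex s) :=
  isCompact_iff_compactSpace.1 (isCompact_closedSimplex s)

instance (K : AbstractSimplicialComplex V) : CompactSpace (realization K) :=
  isCompact_iff_compactSpace.1 (isCompact_realization K)

theorem closedSimplex_subset_realization {K : AbstractSimplicialComplex V} {s : Finset V}
    (hs : s ∈ K.faces) : closedSimplex s ⊆ realization K :=
  fun _ hx => mem_realization.2 ⟨s, hs, hx⟩

/-- The vertices of the smallest simplex containing a point. -/
noncomputable def carrier (x : V → ℝ) : Finset V := by
  classical exact Finset.univ.filter fun v => x v ≠ 0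

@[simp] theorem mem_carrier {x : V → ℝ} {v : V} : v ∈ carrier x ↔ x v ≠ 0 := by
  simp [carrier]

theorem mem_closedSimplex_carrier {x : V → ℝ} {s : Finset V} (hx : x ∈ closedSimplex s) :
    x ∈ closedSimplex (carrier x) :=
  ⟨hx.1, fun v hv => by simpa using hv⟩

theorem carrier_subset {x : V → ℝ} {s : Finset V} (hx : x ∈ closedSimplex s) : carrier x ⊆ s := by
  intro v hv
  by_contra h
  exact mem_carrier.1 hv (hx.2 v h)

theorem carrier_nonempty {x : V → ℝ} {s : Finset V} (hx : x ∈ closedSimplex s) :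
    (carrier x).Nonempty := by
  by_contra h
  have h0 : ∀ v, x v = 0 := fun v => by
    by_contra hv
    exact h ⟨v, mem_carrier.2 hv⟩
  simpa [h0] using (mem_closedSimplex.1 hx).2.1

theorem carrier_mem_faces {K : AbstractSimplicialComplex V} {x : V → ℝ} (hx : x ∈ realization K) :
    carrier x ∈ K.faces := by
  obtain ⟨s, hs, hxs⟩ := mem_realization.1 hx
  exact face_of_subset hs (carrier_subset hxs) (carrier_nonempty hxs)

theorem mem_realization_of_carrier {K : AbstractSimplicialComplex V} {x : V → ℝ}
    (h0 : ∀ v, 0 ≤ x v) (h1 : ∑ v, x v = 1) (h : carrier x ∈ K.faces) : x ∈ realization K :=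
  mem_realization.2 ⟨_, h, mem_closedSimplex.2 ⟨h0, h1, fun v hv => by simpa using hv⟩⟩

theorem single_mem_closedSimplex [DecidableEq V] {s : Finset V} {v : V} (hv : v ∈ s) :
    Pi.single v 1 ∈ closedSimplex s := by
  refine mem_closedSimplex.2 ⟨fun w => ?_, by simp, fun w hw => ?_⟩
  · by_cases h : w = v <;> simp [h]
  · rw [Pi.single_eq_of_ne]; rintro rfl; exact hw hv

theorem sum_smul_single [DecidableEq V] {s : Finset V} {x : V → ℝ} (hx : x ∈ closedSimplex s) :
    ∑ v ∈ s, x v • (Pi.single v 1 : V → ℝ) = x := by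
  ext u
  by_cases hu : u ∈ s
  · rw [Finset.sum_apply, Finset.sum_eq_single_of_mem u hu]
    · simp
    · intro b _ hb
      simp [hb.symm]
  · rw [Finset.sum_apply, hx.2 u hu]
    refine Finset.sum_eq_zero fun b hb => ?_
    have : u ≠ b := by rintro rfl; exact hu hb
    simp [this]

/-- A closed simplex is a retract of `V → ℝ`: clip the coordinates to a subprobability vector
supported on `s` and put the missing mass on one vertex. -/
theorem exists_retraction_closedSimplex {s : Finset V} (hs : s.Nonempty) :
    ∃ r : C(V → ℝ, closedSimplex s), ∀ x (hx : x ∈ closedSimplex s), r x = ⟨x, hx⟩ := by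
  classical
  obtain ⟨v₀, hv₀⟩ := hs
  let y : (V → ℝ) → V → ℝ := fun x v => if v ∈ s then max (x v) 0 else 0
  have hy0 : ∀ x v, 0 ≤ y x v := fun x v => by simp only [y]; split_ifs <;> simp
  have hyc : Continuous y := continuous_pi fun v => by
    by_cases hv : v ∈ s
    · simp only [y, hv, if_true]; fun_prop
    · simp only [y, hv, if_false]; fun_prop
  let z : (V → ℝ) → V → ℝ := fun x v => y x v / max 1 (∑ w, y x w)
  have hpos : ∀ x, 0 < max 1 (∑ w, y x w) := fun x => lt_max_of_lt_left one_pos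
  have hz0 : ∀ x v, 0 ≤ z x v := fun x v => div_nonneg (hy0 x v) (hpos x).le
  have hzc : Continuous z := continuous_pi fun v => by
    refine Continuous.div (by fun_prop) (by fun_prop) fun x => (hpos x).ne'
  have hz1 : ∀ x, ∑ v, z x v ≤ 1 := fun x => by
    simp only [z, ← Finset.sum_div]
    exact (div_le_one (hpos x)).2 (le_max_right _ _)
  let q : (V → ℝ) → V → ℝ := fun x => z x + Pi.single v₀ (1 - ∑ v, z x v)
  have hqc : Continuous q := by
    refine hzc.add ((continuous_single v₀).comp ?_)
    fun_prop
  have hq : ∀ x, q x ∈ closedSimplex s := fun x => by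
    refine mem_closedSimplex.2 ⟨fun v => ?_, ?_, fun v hv => ?_⟩
    · refine add_nonneg (hz0 x v) ?_
      rw [Pi.single_apply]
      split_ifs
      · linarith [hz1 x]
      · exact le_rfl
    · simp [q, Finset.sum_add_distrib]
    · have : v ≠ v₀ := by rintro rfl; exact hv hv₀
      simp [q, z, y, hv, this]
  refine ⟨⟨fun x => ⟨q x, hq x⟩, hqc.subtype_mk _⟩, fun x hx => Subtype.ext ?_⟩
  have hx' := mem_closedSimplex.1 hx
  have hyx : y x = x := by
    ext v
    by_cases hv : v ∈ s
    · simp [y, hv, hx'.1 v]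
    · simp [y, hv, hx'.2.2 v hv]
  have hzx : z x = x := by
    ext v; simp [z, hyx, hx'.2.1]
  change q x = x
  simp [q, hzx, hx'.2.1]

theorem tietzeExtension_closedSimplex {s : Finset V} (hs : s.Nonempty) :
    TietzeExtension (closedSimplex s) := by
  obtain ⟨r, hr⟩ := exists_retraction_closedSimplex hs
  exact TietzeExtension.of_retract ⟨Subtype.val, continuous_subtype_val⟩ r
    (by ext1 x; exact hr x x.2)

end Simplices

/-! ### Simplicial maps in coordinates -/

section SimplicialMaps

variable {V W : Type*} [Fintype V]

/-- The linear map between spaces of barycentric coordinates induced by a map of vertices. -/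
def pushforward [DecidableEq W] (φ : V → W) : (V → ℝ) →ₗ[ℝ] (W → ℝ) where
  toFun x w := ∑ v with φ v = w, x v
  map_add' x y := by ext w; simp [Finset.sum_add_distrib]
  map_smul' c x := by ext w; simp [Finset.mul_sum]

variable [DecidableEq W]

theorem pushforward_apply (φ : V → W) (x : V → ℝ) (w : W) :
    pushforward φ x w = ∑ v with φ v = w, x v := rfl

theorem continuous_pushforward (φ : V → W) : Continuous (pushforward φ) :=
  (pushforward φ).continuous_on_pi

theorem pushforward_single [DecidableEq V] (φ : V → W) (v : V) :
    pushforward φ (Pi.single v 1) = Pi.single (φ v) 1 := by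
  ext w
  simp [pushforward_apply, Pi.single_apply, eq_comm]

variable [Fintype W]

theorem sum_pushforward (φ : V → W) (x : V → ℝ) : ∑ w, pushforward φ x w = ∑ v, x v := by
  simp only [pushforward_apply]
  exact Finset.sum_fiberwise _ _ _

theorem pushforward_mem_closedSimplex (φ : V → W) {s : Finset V} {x : V → ℝ}
    (hx : x ∈ closedSimplex s) : pushforward φ x ∈ closedSimplex (s.image φ) := by
  rw [mem_closedSimplex] at *
  refine ⟨fun w => Finset.sum_nonneg fun v _ => hx.1 v, by rw [sum_pushforward, hx.2.1], ?_⟩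
  intro w hw
  refine Finset.sum_eq_zero fun v hv => hx.2.2 v fun hvs => hw ?_
  rw [← (Finset.mem_filter.1 hv).2]
  exact Finset.mem_image_of_mem φ hvs

theorem carrier_pushforward (φ : V → W) {s : Finset V} {x : V → ℝ} (hx : x ∈ closedSimplex s) :
    carrier (pushforward φ x) = (carrier x).image φ := by
  have hx0 := (mem_closedSimplex.1 hx).1
  ext w
  rw [mem_carrier, Finset.mem_image, pushforward_apply, ne_eq,
    Finset.sum_eq_zero_iff_of_nonneg fun v _ => hx0 v]
  simp [and_comm]

theorem image_pushforward_closedSimplex (φ : V → W) (s : Finset V) :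
    pushforward φ '' closedSimplex s = closedSimplex (s.image φ) := by
  classical
  refine Subset.antisymm ?_ ?_
  · rintro _ ⟨x, hx, rfl⟩
    exact pushforward_mem_closedSimplex φ hx
  intro z hz
  obtain ⟨w, hw⟩ := carrier_nonempty hz
  obtain ⟨v, -, -⟩ := Finset.mem_image.1 (carrier_subset hz hw)
  have : Nonempty V := ⟨v⟩
  have hex : ∀ w ∈ s.image φ, ∃ v ∈ s, φ v = w := fun w hw => Finset.mem_image.1 hw
  choose! σ hσs hσ using hex
  have hpush : pushforward φ (∑ w ∈ s.image φ, z w • (Pi.single (σ w) 1 : V → ℝ)) = z := by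
    rw [map_sum]
    have : ∀ w ∈ s.image φ, pushforward φ (z w • (Pi.single (σ w) 1 : V → ℝ))
        = z w • (Pi.single w 1 : W → ℝ) := fun w hw => by
      rw [map_smul, pushforward_single, hσ w hw]
    rw [Finset.sum_congr rfl this]
    exact sum_smul_single hz
  refine ⟨_, ?_, hpush⟩
  refine mem_closedSimplex.2 ⟨fun v => ?_, ?_, fun v hv => ?_⟩
  · rw [Finset.sum_apply]
    refine Finset.sum_nonneg fun w _ => ?_
    have := (mem_closedSimplex.1 hz).1 w
    by_cases h : v = σ w
    · subst h; simpa
    · simp [h]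
  · rw [← sum_pushforward φ, hpush, (mem_closedSimplex.1 hz).2.1]
  · rw [Finset.sum_apply]
    refine Finset.sum_eq_zero fun w hw => ?_
    have : v ≠ σ w := by rintro rfl; exact hv (hσs w hw)
    simp [this]

variable {K : AbstractSimplicialComplex V} {M : AbstractSimplicialComplex W}

/-- A simplicial map is determined by a map of vertices. -/
theorem IsSimplicialMap.exists_vertexMap {p : realization K → realization M}
    (hp : IsSimplicialMap p) :
    ∃ φ : V → W, (∀ x, (p x : W → ℝ) = pushforward φ x) ∧ ∀ s ∈ K.faces, s.image φ ∈ M.faces := by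
  classical
  have hmem : ∀ v : V, Pi.single v 1 ∈ realization K := fun v =>
    closedSimplex_subset_realization (K.singleton_mem v) (single_mem_closedSimplex (by simp))
  have hvert : ∀ v : V, ∃ w, (p ⟨_, hmem v⟩ : W → ℝ) = Pi.single w 1 := by
    intro v
    obtain ⟨t, ht, him⟩ := hp.maps_onto {v} (K.singleton_mem v)
    obtain ⟨w, hw⟩ := face_nonempty ht
    have hw' : (Pi.single w 1 : W → ℝ) ∈ closedSimplex t := single_mem_closedSimplex hw
    rw [← him] at hw'
    obtain ⟨x, hx, hxw⟩ := hw'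
    have hxv : x = ⟨_, hmem v⟩ := by
      refine Subtype.ext (funext fun u => ?_)
      have hx' := mem_closedSimplex.1 hx
      have h0 : ∀ u, u ≠ v → (x : V → ℝ) u = 0 := fun u hu => hx'.2.2 u (by simpa using hu)
      by_cases hu : u = v
      · subst hu
        have := hx'.2.1
        rw [Fintype.sum_eq_single u h0] at this
        simpa using this
      · simp [hu, h0 u hu]
    exact ⟨w, hxv ▸ hxw⟩
  choose φ hφ using hvert
  have hform : ∀ x, (p x : W → ℝ) = pushforward φ x := by
    intro x
    obtain ⟨s, hs, hx⟩ := mem_realization.1 x.2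
    have hsub := closedSimplex_subset_realization hs
    ext w
    -- each coordinate of `p` is both convex and concave on a simplex
    let q : (V → ℝ) → ℝ := fun y => if h : y ∈ realization K then (p ⟨y, h⟩ : W → ℝ) w else 0
    have hq : ∀ y : realization K, q y = (p y : W → ℝ) w := fun y => by simp [q]
    have hlin : ∀ y ∈ closedSimplex s, ∀ z ∈ closedSimplex s, ∀ a b : ℝ, 0 ≤ a → 0 ≤ b →
        a + b = 1 → q (a • y + b • z) = a • q y + b • q z := by
      intro y hy z hz a b ha hb hab
      have := hp.linear s hs ⟨y, hsub hy⟩ ⟨z, hsub hz⟩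
        ⟨_, hsub (convex_closedSimplex s hy hz ha hb hab)⟩ hy hz a b ha hb hab rfl
      have := congrFun this w
      simpa only [← hq, Pi.add_apply, Pi.smul_apply] using this
    have hcvx : ConvexOn ℝ (closedSimplex s) q :=
      ⟨convex_closedSimplex s, fun y hy z hz a b ha hb hab =>
        (hlin y hy z hz a b ha hb hab).le⟩
    have hccv : ConcaveOn ℝ (closedSimplex s) q :=
      ⟨convex_closedSimplex s, fun y hy z hz a b ha hb hab =>
        (hlin y hy z hz a b ha hb hab).ge⟩
    have hx' := mem_closedSimplex.1 hx
    have hsum : ∑ v ∈ s, (x : V → ℝ) v = 1 := by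
      rw [← hx'.2.1]
      exact Finset.sum_subset (Finset.subset_univ s) fun v _ hv => hx'.2.2 v hv
    have hxs : ∑ v ∈ s, (x : V → ℝ) v • (Pi.single v 1 : V → ℝ) = x :=
      sum_smul_single hx
    have hle := hcvx.map_sum_le (t := s) (w := (x : V → ℝ)) (p := fun v => Pi.single v 1)
      (fun v _ => hx'.1 v) hsum fun v hv => single_mem_closedSimplex hv
    have hge := hccv.le_map_sum (t := s) (w := (x : V → ℝ)) (p := fun v => Pi.single v 1)
      (fun v _ => hx'.1 v) hsum fun v hv => single_mem_closedSimplex hv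
    rw [hxs] at hle hge
    have heq := le_antisymm hle hge
    rw [hq] at heq
    rw [heq]
    conv_rhs => rw [← hxs, map_sum, Finset.sum_apply]
    refine Finset.sum_congr rfl fun v _ => ?_
    rw [map_smul, pushforward_single, Pi.smul_apply, ← hφ, ← hq]
  refine ⟨φ, hform, fun s hs => ?_⟩
  obtain ⟨t, ht, him⟩ := hp.maps_onto s hs
  have him' : pushforward φ '' closedSimplex s = closedSimplex t := by
    rw [← him]
    ext z
    constructor
    · rintro ⟨x, hx, rfl⟩
      exact ⟨⟨x, closedSimplex_subset_realization hs hx⟩, hx, hform _⟩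
    · rintro ⟨x, hx, rfl⟩
      exact ⟨x, hx, (hform x).symm⟩
  rw [image_pushforward_closedSimplex] at him'
  convert ht
  have hsub : ∀ a b : Finset W, closedSimplex a ⊆ closedSimplex b → a ⊆ b := by
    intro a b hab w hw
    by_contra hwb
    simpa using (hab (single_mem_closedSimplex hw)).2 w hwb
  exact (hsub _ _ him'.le).antisymm (hsub _ _ him'.ge)

end SimplicialMaps

/-! ### Extension of small homotopies -/

section Extension

/-- Homotopy extension with control. The space `K` collapses onto arbitrarily small neighbourhoods
of itself by a deformation `E` whose stage `u` carries the neighbourhood `{a ≤ u}` of `S` into `S`;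
then every small deformation of `f` on `S` extends to a small deformation of `f`. -/
theorem exists_covering_extension_of_collapse {K X : Type*} [TopologicalSpace K] [CompactSpace K]
    [T2Space K] [TopologicalSpace X] [T2Space X] {S : Set K}
    (E : C(unitInterval × K, K)) (a : C(K, ℝ)) (hE0 : ∀ x, E (0, x) = x)
    (hES : ∀ u, ∀ x ∈ S, E (u, x) = x) (haS : ∀ x ∈ S, a x = 0)
    (haE : ∀ (u : unitInterval) (x : K), a x ≤ u → E (u, x) ∈ S)
    {𝒰 : Set (Set X)} (h𝒰 : IsOpenCovering 𝒰) (f : C(K, X)) :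
    ∃ 𝒱 : Set (Set X), IsOpenCovering 𝒱 ∧
      ∀ φ : C(S, X), UHomotopic 𝒱 φ (f.restrict S) →
        ∃ f' : C(K, X), UHomotopic 𝒰 f' f ∧ ∀ x : S, f' x = φ x := by
  obtain ⟨c, hc, hcU⟩ := exists_forall_le_mem_covering h𝒰 (f.comp E)
  have hc0 : (0 : ℝ) < c := hc
  let f₁ : C(K, X) := ⟨fun x => f (E (c, x)), by fun_prop⟩
  have hf₁ : UHomotopic 𝒰 f₁ f := by
    refine ⟨⟨⟨fun z => f (E (unitInterval.symm z.1 * c, z.2)), by fun_prop⟩, ?_, ?_⟩, fun x => ?_⟩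
    · intro x; simp [f₁]
    · intro x; simp [hE0]
    · obtain ⟨U, hU, h⟩ := hcU c le_rfl x
      exact ⟨U, hU, fun t => h _ unitInterval.mul_le_right⟩
  obtain ⟨𝒱, h𝒱, h𝒱U⟩ := hf₁.exists_covering_trans h𝒰
  refine ⟨𝒱, h𝒱, fun φ hφ => ?_⟩
  obtain ⟨h, hh⟩ := hφ.symm
  classical
  let hext : unitInterval × K → X := fun z => if hz : z.2 ∈ S then h (z.1, ⟨z.2, hz⟩) else f z.2
  have hext0 : ∀ y, hext (0, y) = f y := fun y => by
    by_cases hy : y ∈ S <;> simp [hext, hy]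
  have hextc : ContinuousOn hext (univ ×ˢ S) := by
    rw [continuousOn_iff_continuous_domRestrict]
    have : (univ ×ˢ S).domRestrict hext =
        fun z : (univ ×ˢ S : Set (unitInterval × K)) => h (z.1.1, ⟨z.1.2, z.2.2⟩) := by
      ext z
      have hz : z.1.2 ∈ S := z.2.2
      simp [hext, hz]
    rw [this]
    fun_prop
  -- the deformation takes place at full speed on `S` and fades out where `a` reaches `c`
  let l : K → unitInterval := fun x => projIcc 0 1 zero_le_one (1 - a x / c)
  have hlc : Continuous l := continuous_projIcc.comp (by fun_prop)
  have hl0 : ∀ x, c ≤ a x → l x = 0 := fun x hx => by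
    refine projIcc_of_le_left _ ?_
    linarith [(one_le_div hc0).2 hx]
  have hl1 : ∀ x ∈ S, l x = 1 := fun x hx => by
    refine projIcc_of_right_le _ ?_
    simp [haS x hx]
  let H : unitInterval × K → X := fun z => hext (z.1 * l z.2, E (c, z.2))
  have hHc : Continuous H := by
    have hcov : {z : unitInterval × K | a z.2 ≤ c} ∪ {z | c ≤ a z.2} = univ :=
      eq_univ_of_forall fun z => le_total (a z.2) c
    rw [← continuousOn_univ, ← hcov]
    refine ContinuousOn.union_of_isClosed ?_ ?_ (isClosed_le (by fun_prop) (by fun_prop))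
      (isClosed_le (by fun_prop) (by fun_prop))
    · refine hextc.comp (Continuous.continuousOn (by fun_prop)) fun z hz => ⟨mem_univ _, haE _ _ hz⟩
    · have : ContinuousOn (fun z : unitInterval × K => f₁ z.2) {z | c ≤ a z.2} :=
        Continuous.continuousOn (by fun_prop)
      refine this.congr fun z hz => ?_
      simp [H, hl0 z.2 hz, hext0, f₁]
  have hmem : ∀ x, ∃ V ∈ 𝒱, ∀ t, H (t, x) ∈ V := by
    intro x
    by_cases hES : E (c, x) ∈ S
    · obtain ⟨V, hV, hVh⟩ := hh ⟨_, hES⟩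
      refine ⟨V, hV, fun t => ?_⟩
      simpa [H, hext, hES] using hVh _
    · obtain ⟨V, hV, hVx⟩ := h𝒱.exists_mem (f (E (c, x)))
      refine ⟨V, hV, fun t => ?_⟩
      simpa [H, hext, hES] using hVx
  refine ⟨⟨fun x => H (1, x), by fun_prop⟩, h𝒱U _ (UHomotopic.symm ⟨⟨⟨H, hHc⟩, ?_, ?_⟩, hmem⟩), ?_⟩
  · intro x; simp [H, hext0, f₁]
  · intro x; rfl
  · rintro ⟨x, hxS⟩
    simp [H, hES c x hxS, hl1 x hxS, hext, hxS]

variable {V X : Type*} [Fintype V] [TopologicalSpace X] {K : AbstractSimplicialComplex V}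

/-- A deformation of a complex carrying neighbourhoods of a simplex into that simplex: cut off
the coordinates outside of `s` by a small amount and normalize. -/
theorem exists_collapse (K : AbstractSimplicialComplex V) (s : Finset V) :
    ∃ (E : C(unitInterval × realization K, realization K)) (a : C(realization K, ℝ)),
      (∀ x, E (0, x) = x) ∧ (∀ u (x : realization K), (x : V → ℝ) ∈ closedSimplex s → E (u, x) = x) ∧
      (∀ x : realization K, (x : V → ℝ) ∈ closedSimplex s → a x = 0) ∧
      ∀ (u : unitInterval) (x : realization K), a x ≤ u →
        (E (u, x) : V → ℝ) ∈ closedSimplex s := by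
  classical
  -- cutting every coordinate by at most `c` leaves a positive total mass
  let c : ℝ := 1 / (Fintype.card V + 1)
  have hc : 0 < c := by positivity
  have hcV : Fintype.card V * c < 1 := by
    simp only [c, mul_one_div]
    rw [div_lt_one (by positivity)]
    linarith
  let y : unitInterval × realization K → V → ℝ := fun z v =>
    if v ∈ s then (z.2 : V → ℝ) v else max ((z.2 : V → ℝ) v - z.1 * c) 0
  have hyc : ∀ v, Continuous fun z => y z v := fun v => by
    have h2 : Continuous fun z : unitInterval × realization K => (z.2 : V → ℝ) v :=
      (continuous_apply v).comp (continuous_subtype_val.comp continuous_snd)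
    by_cases hv : v ∈ s
    · simpa only [y, hv, if_true] using h2
    · simp only [y, hv, if_false]; fun_prop
  have hx : ∀ x : realization K, (∀ v, 0 ≤ (x : V → ℝ) v) ∧ ∑ v, (x : V → ℝ) v = 1 := fun x => by
    obtain ⟨t, -, hxt⟩ := mem_realization.1 x.2
    exact ⟨hxt.1.1, hxt.1.2⟩
  have hy0 : ∀ z v, 0 ≤ y z v := fun z v => by
    simp only [y]
    split_ifs
    · exact (hx z.2).1 v
    · exact le_max_right _ _
  have hyx : ∀ z v, (z.2 : V → ℝ) v - c ≤ y z v := fun z v => by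
    simp only [y]
    split_ifs
    · linarith
    · refine le_max_of_le_left ?_
      have := mul_le_of_le_one_left hc.le z.1.2.2
      linarith
  have hpos : ∀ z, 0 < ∑ v, y z v := fun z => by
    have := Finset.sum_le_sum fun v (_ : v ∈ Finset.univ) => hyx z v
    rw [Finset.sum_sub_distrib, (hx z.2).2] at this
    simp only [Finset.sum_const, Finset.card_univ, nsmul_eq_mul] at this
    linarith
  have hmem : ∀ z, (fun v => y z v / ∑ w, y z w) ∈ realization K := fun z => by
    have h1 : ∑ v, y z v / ∑ w, y z w = 1 := by
      rw [← Finset.sum_div, div_self (hpos z).ne']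
    have h0 : ∀ v, 0 ≤ y z v / ∑ w, y z w := fun v => div_nonneg (hy0 z v) (hpos z).le
    refine mem_realization.2 ⟨_, carrier_mem_faces z.2.2, mem_closedSimplex.2 ⟨h0, h1, ?_⟩⟩
    intro v hv
    have hv' : (z.2 : V → ℝ) v = 0 := by simpa using hv
    have : 0 ≤ z.1 * c := mul_nonneg z.1.2.1 hc.le
    simp [y, hv', this]
  have hfix : ∀ z, (∀ v, y z v = (z.2 : V → ℝ) v) → (⟨_, hmem z⟩ : realization K) = z.2 := by
    intro z hz
    refine Subtype.ext (funext fun v => ?_)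
    simp [hz, (hx z.2).2]
  refine ⟨⟨fun z => ⟨_, hmem z⟩, Continuous.subtype_mk (continuous_pi fun v => ?_) _⟩,
    ⟨fun x => (∑ v with v ∉ s, (x : V → ℝ) v) / c, by fun_prop⟩, ?_, ?_, ?_, ?_⟩
  · exact (hyc v).div (continuous_finsetSum _ fun w _ => hyc w) fun z => (hpos z).ne'
  · intro x
    refine hfix (0, x) fun v => ?_
    simp [y, (hx x).1 v]
  · intro u x hxs
    refine hfix (u, x) fun v => ?_
    by_cases hv : v ∈ s
    · simp [y, hv]
    · have : 0 ≤ u * c := mul_nonneg u.2.1 hc.le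
      simp [y, hv, hxs.2 v hv, this]
  · intro x hxs
    simp only [ContinuousMap.coe_mk]
    rw [Finset.sum_eq_zero, zero_div]
    intro v hv
    exact hxs.2 v (by simpa using hv)
  · intro u x hxu
    obtain ⟨t, -, ht⟩ := mem_realization.1 (hmem (u, x))
    refine ⟨ht.1, fun v hv => ?_⟩
    have h1 : ∑ v with v ∉ s, (x : V → ℝ) v ≤ u * c := (div_le_iff₀ hc).1 hxu
    have h2 : (x : V → ℝ) v ≤ ∑ v with v ∉ s, (x : V → ℝ) v :=
      Finset.single_le_sum (f := (x : V → ℝ)) (fun w _ => (hx x).1 w) (by simpa using hv)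
    have h3 : y (u, x) v = 0 := by simp [y, hv, h2.trans h1]
    simp [h3]

/-- Sufficiently small deformations of a map on a simplex extend to small deformations on the whole
complex. -/
theorem exists_covering_extension [T2Space X] {s : Finset V} (hs : s ∈ K.faces)
    {𝒰 : Set (Set X)} (h𝒰 : IsOpenCovering 𝒰) (f : C(realization K, X)) :
    ∃ 𝒱 : Set (Set X), IsOpenCovering 𝒱 ∧ ∀ φ : C(closedSimplex s, X),
      UHomotopic 𝒱 φ (f.comp (.inclusion (closedSimplex_subset_realization hs))) →
      ∃ f' : C(realization K, X), UHomotopic 𝒰 f' f ∧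
        ∀ x : closedSimplex s, f' (inclusion (closedSimplex_subset_realization hs) x) = φ x := by
  obtain ⟨E, a, h0, h1, h2, h3⟩ := exists_collapse K s
  obtain ⟨𝒱, h𝒱, h⟩ := exists_covering_extension_of_collapse
    (S := {x : realization K | (x : V → ℝ) ∈ closedSimplex s})
    E a h0
    (fun u x hx => h1 u x hx) h2 h3 h𝒰 f
  refine ⟨𝒱, h𝒱, fun φ hφ => ?_⟩
  let r : C({x : realization K | (x : V → ℝ) ∈ closedSimplex s}, closedSimplex s) :=
    ⟨fun x => ⟨x.1.1, x.2⟩, by fun_prop⟩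
  obtain ⟨f', hf', hf'φ⟩ := h (φ.comp r) (hφ.comp_right r)
  exact ⟨f', hf', fun x => hf'φ ⟨inclusion (closedSimplex_subset_realization hs) x, x.2⟩⟩

end Extension

/-! ### Coordinates on the fibres of a simplicial map -/

section FiberCoordinates

variable {V W : Type*} [Fintype V] [DecidableEq V] [DecidableEq W]

/-- On a simplex, a point of a fibre is determined by the coordinates outside of a set of
representatives for the vertices of the image. -/
theorem eq_of_pushforward_eq {φ : V → W} {s R : Finset V} (hR : InjOn φ R) {x y : V → ℝ}
    (hx : ∀ v, v ∉ s → x v = 0) (hy : ∀ v, v ∉ s → y v = 0)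
    (hxy : pushforward φ x = pushforward φ y) (h : ∀ v ∈ s \ R, x v = y v) : x = y := by
  have h' : ∀ v, v ∉ R → x v = y v := fun v hv => by
    by_cases hvs : v ∈ s
    · exact h v (Finset.mem_sdiff.2 ⟨hvs, hv⟩)
    · rw [hx v hvs, hy v hvs]
  ext v
  by_cases hv : v ∈ R
  · have h1 := congrFun hxy (φ v)
    rw [pushforward_apply, pushforward_apply,
      ← Finset.add_sum_erase _ _ (show v ∈ Finset.univ.filter fun u => φ u = φ v by simp),
      ← Finset.add_sum_erase _ _ (show v ∈ Finset.univ.filter fun u => φ u = φ v by simp)] at h1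
    rw [Finset.sum_congr rfl fun u hu => h' u fun huR => ?_] at h1
    · exact add_right_cancel h1
    · simp only [Finset.mem_erase, Finset.mem_filter, Finset.mem_univ, true_and] at hu
      exact hu.1 (hR huR hv hu.2)
  · exact h' v hv

/-- The fibre of a simplicial map over the barycenter of the image of a simplex `s` contains a
simplex with one vertex more than the number of vertices of `s` that are not needed to cover the
image. -/
theorem card_sdiff_le_of_mapDimLE [Fintype W] {K : AbstractSimplicialComplex V}
    {M : AbstractSimplicialComplex W} {p : realization K → realization M} {φ : V → W}
    (hp : ∀ x, (p x : W → ℝ) = pushforward φ x) {n : ℕ∞} (hn : MapDimLE p n) {s R : Finset V}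
    (hs : s ∈ K.faces) (hRs : R ⊆ s) (himg : R.image φ = s.image φ) :
    ((s \ R).card : ℕ∞) ≤ n := by
  have hR0 : R.Nonempty := by
    rw [← Finset.image_nonempty (f := φ), himg, Finset.image_nonempty]
    exact face_nonempty hs
  let c : ℝ := 1 / R.card
  have hc : 0 < c := by
    have : (0 : ℝ) < R.card := by exact_mod_cast hR0.card_pos
    positivity
  have hex : ∀ v : (s \ R : Finset V), ∃ r ∈ R, φ r = φ v := fun v => by
    have := Finset.mem_image_of_mem φ (Finset.mem_sdiff.1 v.2).1
    rw [← himg] at this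
    exact Finset.mem_image.1 this
  choose r hrR hr using hex
  let x₀ : V → ℝ := fun v => if v ∈ R then c else 0
  -- the barycenter of `R`, and its translates by shifting the mass of a vertex of `R` to a vertex
  -- outside of `R` with the same image
  let P : Option (s \ R : Finset V) → V → ℝ := fun o =>
    o.elim x₀ fun v => x₀ + c • (Pi.single (v : V) 1 - Pi.single (r v) 1)
  have hx₀ : x₀ ∈ closedSimplex s := by
    refine mem_closedSimplex.2 ⟨fun v => ?_, ?_, fun v hv => ?_⟩
    · simp only [x₀]; split_ifs <;> simp [hc.le]
    · have : (R.card : ℝ) ≠ 0 := by exact_mod_cast hR0.card_pos.ne'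
      simp [x₀, c, this]
    · have : v ∉ R := fun h => hv (hRs h)
      simp [x₀, this]
  have hP : ∀ o, P o ∈ closedSimplex s := by
    rintro (_ | v)
    · exact hx₀
    have hvs := Finset.mem_sdiff.1 v.2
    refine mem_closedSimplex.2 ⟨fun u => ?_, ?_, fun u hu => ?_⟩
    · by_cases hu : u = r v
      · have hne : r v ≠ v := fun h => hvs.2 (h ▸ hrR v)
        simp [P, x₀, hu, hrR v, hne]
      · have h0 := (mem_closedSimplex.1 hx₀).1 u
        by_cases huv : u = v
        · simp only [P, Option.elim, Pi.add_apply, Pi.smul_apply, Pi.sub_apply, huv,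
            smul_eq_mul, Pi.single_eq_same]
          rw [Pi.single_eq_of_ne (huv ▸ hu)]
          rw [huv] at h0
          linarith
        · simpa [P, hu, huv] using h0
    · simp [P, Finset.sum_add_distrib, ← Finset.mul_sum, (mem_closedSimplex.1 hx₀).2.1]
    · have h1 : u ≠ v := by rintro rfl; exact hu hvs.1
      have h2 : u ≠ r v := by rintro rfl; exact hu (hRs (hrR v))
      simp [P, h1, h2, hx₀.2 u hu]
  have hpush : ∀ o, pushforward φ (P o) = pushforward φ x₀ := by
    rintro (_ | v)
    · rfl
    · simp [P, map_add, map_sub, pushforward_single, hr]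
  have hPv : ∀ o (v : (s \ R : Finset V)), P o v = if o = some v then c else 0 := by
    intro o v
    have hv := (Finset.mem_sdiff.1 v.2).2
    rcases o with _ | w
    · simp [P, x₀, hv]
    · have h2 : (v : V) ≠ r w := by intro h; exact hv (h ▸ hrR w)
      by_cases h : w = v
      · subst h; simp [P, x₀, hv, h2]
      · have h3 : (v : V) ≠ w := fun h' => h (Subtype.ext h'.symm)
        simp [P, x₀, hv, h2, h, h3]
  have hind : AffineIndependent ℝ P := by
    rw [affineIndependent_iff]
    intro F w hw0 hw
    have hsome : ∀ v, some v ∈ F → w (some v) = 0 := by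
      intro v hv
      have h := congrFun hw v
      simp only [Finset.sum_apply, Pi.smul_apply, hPv, smul_eq_mul, mul_ite, mul_zero,
        Finset.sum_ite_eq', hv, if_true, Pi.zero_apply] at h
      exact (mul_eq_zero.1 h).resolve_right hc.ne'
    rintro (_ | v) ho
    · rwa [Finset.sum_eq_single_of_mem none ho] at hw0
      rintro (_ | v) hv hne
      · exact absurd rfl hne
      · exact hsome v hv
    · exact hsome v ho
  have hconv : Convex ℝ {x | x ∈ closedSimplex s ∧ pushforward φ x = pushforward φ x₀} := by
    refine (convex_closedSimplex s).inter ?_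
    exact (convex_singleton (pushforward φ x₀)).is_linear_preimage (pushforward φ).isLinear
  have hsub := closedSimplex_subset_realization hs
  have hcard := hn (p ⟨x₀, hsub hx₀⟩) (Finset.univ.image P) (by
      have := hind.range
      rwa [show (Finset.univ.image P : Finset (V → ℝ)) = (range P).toFinset by
        ext; simp, ← coe_toFinset (range P)] at *) ?_
  · rw [Finset.card_image_of_injective _ hind.injective, Finset.card_univ, Fintype.card_option,
      Fintype.card_coe] at hcard
    push_cast at hcard
    exact (ENat.add_le_add_iff_right ENat.one_ne_top).1 hcard
  · refine (convexHull_min (t := {x | x ∈ closedSimplex s ∧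
      pushforward φ x = pushforward φ x₀}) ?_ hconv).trans ?_
    · intro x hx
      obtain ⟨o, rfl⟩ : ∃ o, P o = x := by simpa using hx
      exact ⟨hP o, hpush o⟩
    · rintro x ⟨hx, hxp⟩
      refine ⟨⟨x, hsub hx⟩, ?_, rfl⟩
      refine Subtype.ext ?_
      rw [hp, hp]
      exact hxp

end FiberCoordinates

/-! ### Simplices as retracts of products of cubes -/

section Models

/-- At most `n` coordinates with values in `[0,1]` can be recorded in the cube `[0,1]^n`. -/
theorem exists_coordinates {V : Type*} (T : Finset V) {n : ℕ∞} (hT : (T.card : ℕ∞) ≤ n) :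
    ∃ l : C(V → ℝ, Cube n), ∀ x y : V → ℝ, (∀ v, x v ∈ Icc (0 : ℝ) 1) →
      (∀ v, y v ∈ Icc (0 : ℝ) 1) → l x = l y → ∀ v ∈ T, x v = y v := by
  refine ⟨⟨fun x i => if h : (i : ℕ) < T.card then
    projIcc 0 1 zero_le_one (x (T.equivFin.symm ⟨i, h⟩)) else 0, ?_⟩, ?_⟩
  · refine continuous_pi fun i => ?_
    by_cases h : (i : ℕ) < T.card
    · simp only [h, dif_pos]
      exact continuous_projIcc.comp (continuous_apply _)
    · simp only [h, dif_neg, not_false_eq_true]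
      exact continuous_const
  · intro x y hx hy hxy v hv
    let i := T.equivFin ⟨v, hv⟩
    have h := congrFun hxy ⟨i, lt_of_lt_of_le (by exact_mod_cast i.2) hT⟩
    have hi : T.equivFin.symm i = ⟨v, hv⟩ := by simp [i]
    simp only [ContinuousMap.coe_mk, i.2, dif_pos, Fin.eta, hi] at h
    rw [projIcc_of_mem zero_le_one (hx v), projIcc_of_mem zero_le_one (hy v)] at h
    exact congrArg Subtype.val h

variable {V W : Type*} [Fintype V] [Fintype W]

theorem mem_Icc_of_mem_closedSimplex {s : Finset V} {x : V → ℝ} (hx : x ∈ closedSimplex s) (v : V) :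
    x v ∈ Icc (0 : ℝ) 1 := by
  have hx' := mem_closedSimplex.1 hx
  exact ⟨hx'.1 v, hx'.2.1 ▸ Finset.single_le_sum (fun w _ => hx'.1 w) (Finset.mem_univ v)⟩

/-- An `m`-dimensional simplex embeds into the cube `[0,1]^m`. -/
theorem exists_injOn_closedSimplex {s : Finset V} {m : ℕ∞} (hs : (s.card : ℕ∞) ≤ m + 1) :
    ∃ j : C(V → ℝ, Cube m), InjOn j (closedSimplex s) := by
  classical
  rcases s.eq_empty_or_nonempty with rfl | ⟨v₀, hv₀⟩
  · refine ⟨.const _ 0, fun x hx => ?_⟩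
    simpa using carrier_nonempty hx |>.mono (carrier_subset hx)
  have hcard : ((s.erase v₀).card : ℕ∞) ≤ m := by
    rw [← Finset.card_erase_add_one hv₀] at hs
    push_cast at hs
    exact (ENat.add_le_add_iff_right ENat.one_ne_top).1 hs
  obtain ⟨j, hj⟩ := exists_coordinates (s.erase v₀) hcard
  refine ⟨j, fun x hx y hy hxy => ?_⟩
  have h1 := hj x y (mem_Icc_of_mem_closedSimplex hx) (mem_Icc_of_mem_closedSimplex hy) hxy
  have h2 : ∀ v, v ≠ v₀ → x v = y v := fun v hv => by
    by_cases hvs : v ∈ s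
    · exact h1 v (Finset.mem_erase.2 ⟨hv, hvs⟩)
    · rw [hx.2 v hvs, hy.2 v hvs]
  ext v
  by_cases hv : v = v₀
  · subst hv
    have h3 := (mem_closedSimplex.1 hx).2.1.trans (mem_closedSimplex.1 hy).2.1.symm
    rw [← Finset.add_sum_erase _ x (Finset.mem_univ v),
      ← Finset.add_sum_erase _ y (Finset.mem_univ v),
      Finset.sum_congr rfl fun u hu => h2 u (Finset.ne_of_mem_erase hu)] at h3
    exact add_right_cancel h3
  · exact h2 v hv

/-- For a simplicial map with fibres of dimension at most `n`, each simplex `s` embeds as a retract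
into `[0,1]^m × [0,1]^n` over any embedding of the image of `s` into `[0,1]^m`. The retraction need
not respect the fibres. -/
theorem exists_retract_cube [DecidableEq W] {K : AbstractSimplicialComplex V}
    {M : AbstractSimplicialComplex W} {p : realization K → realization M} {φ : V → W}
    (hp : ∀ x, (p x : W → ℝ) = pushforward φ x) {m n : ℕ∞} (hn : MapDimLE p n) {s : Finset V}
    (hs : s ∈ K.faces) {j : C(W → ℝ, Cube m)} (hj : InjOn j (closedSimplex (s.image φ))) :
    ∃ (i : C(closedSimplex s, Cube m × Cube n)) (r : C(Cube m × Cube n, closedSimplex s)),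
      r.comp i = .id _ ∧ ∀ x, (i x).1 = j (pushforward φ x) := by
  classical
  obtain ⟨R, hRs, hR, himg⟩ :=
    Finset.exists_subset_injOn_image_eq_of_surjOn (f := φ) s (s.image φ) (by
      rw [Finset.coe_image]
      exact surjOn_image φ s)
  obtain ⟨l, hl⟩ := exists_coordinates (s \ R) (card_sdiff_le_of_mapDimLE hp hn hs hRs himg)
  have hpc := continuous_pushforward φ
  let i : C(closedSimplex s, Cube m × Cube n) := ⟨fun x => (j (pushforward φ x), l x), by fun_prop⟩
  have hi : Function.Injective i := by
    intro x y hxy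
    have h1 : j (pushforward φ x) = j (pushforward φ y) := congrArg Prod.fst hxy
    have h2 : l x = l y := congrArg Prod.snd hxy
    exact Subtype.ext (eq_of_pushforward_eq hR x.2.2 y.2.2
      (hj (pushforward_mem_closedSimplex φ x.2) (pushforward_mem_closedSimplex φ y.2) h1)
      (hl _ _ (mem_Icc_of_mem_closedSimplex x.2) (mem_Icc_of_mem_closedSimplex y.2) h2))
  have := tietzeExtension_closedSimplex (face_nonempty hs)
  obtain ⟨r, hr⟩ := (ContinuousMap.id (closedSimplex s)).exists_extension
    (i.continuous.isClosedEmbedding hi)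
  exact ⟨i, r, hr, fun x => rfl⟩

end Models

/-! ### Separating the fibres of simplicial maps -/

section GeneralPosition

universe u v w x

variable {X : Type u} [TopologicalSpace X] [T2Space X] {A : Type v} {B : Type w} {C : Type x}
  [Fintype A] [Fintype B] [Fintype C]
  {N : AbstractSimplicialComplex A} {K : AbstractSimplicialComplex B}
  {M : AbstractSimplicialComplex C} {pN : realization N → realization M}
  {pK : realization K → realization M} {φ : A → C} {ψ : B → C} {m n k : ℕ∞}

/-- Separation over a single pair of simplices with the same image: both embed as retracts
into products of cubes, over the same embedding of the image into `[0,1]^m`. -/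
theorem HasHDD.exists_disjoint_on_closedSimplex [DecidableEq C] (hX : HasHDD X m n k)
    (hpN : ∀ x, (pN x : C → ℝ) = pushforward φ x) (hpK : ∀ x, (pK x : C → ℝ) = pushforward ψ x)
    (hn : MapDimLE pN n) (hk : MapDimLE pK k) {s : Finset A} {t : Finset B} (hs : s ∈ N.faces)
    (ht : t ∈ K.faces) (hst : s.image φ = t.image ψ) (hm : ((s.image φ).card : ℕ∞) ≤ m + 1)
    {𝒰 : Set (Set X)} (h𝒰 : IsOpenCovering 𝒰) (f : C(realization N, X)) (g : C(realization K, X)) :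
    ∃ (f' : C(realization N, X)) (g' : C(realization K, X)),
      UHomotopic 𝒰 f' f ∧ UHomotopic 𝒰 g' g ∧
      ∀ (x : realization N) (y : realization K), (x : A → ℝ) ∈ closedSimplex s →
        (y : B → ℝ) ∈ closedSimplex t → pN x = pK y → f' x ≠ g' y := by
  obtain ⟨j, hj⟩ := exists_injOn_closedSimplex hm
  obtain ⟨iN, rN, hN, hiN⟩ := exists_retract_cube hpN hn hs hj
  obtain ⟨iK, rK, hK, hiK⟩ := exists_retract_cube hpK hk ht (hst ▸ hj)
  obtain ⟨𝒱, h𝒱, hf⟩ := exists_covering_extension hs h𝒰 f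
  obtain ⟨𝒱', h𝒱', hg⟩ := exists_covering_extension ht h𝒰 g
  let f₀ := f.comp (.inclusion (closedSimplex_subset_realization hs))
  let g₀ := g.comp (.inclusion (closedSimplex_subset_realization ht))
  obtain ⟨f₁, g₁, hf₁, hg₁, hdisj⟩ := hX _ (h𝒱.inter h𝒱') (f₀.comp rN) (g₀.comp rK)
  obtain ⟨f', hf', hf'₁⟩ := hf (f₁.comp iN) (by
    simpa only [ContinuousMap.comp_assoc, hN, ContinuousMap.comp_id] using
      hf₁.of_inter_left.comp_right iN)
  obtain ⟨g', hg', hg'₁⟩ := hg (g₁.comp iK) (by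
    simpa only [ContinuousMap.comp_assoc, hK, ContinuousMap.comp_id] using
      hg₁.of_inter_right.comp_right iK)
  refine ⟨f', g', hf', hg', fun x y hx hy hxy heq => ?_⟩
  have h1 : f' x = f₁ (iN ⟨x, hx⟩) := hf'₁ ⟨x, hx⟩
  have h2 : g' y = g₁ (iK ⟨y, hy⟩) := hg'₁ ⟨y, hy⟩
  have h3 : (iN ⟨x, hx⟩).1 = (iK ⟨y, hy⟩).1 := by
    rw [hiN, hiK, ← hpN, ← hpK, hxy]
  refine disjoint_left.1 (hdisj (iN ⟨x, hx⟩).1) ⟨iN ⟨x, hx⟩, ⟨rfl, mem_univ _⟩, rfl⟩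
    ⟨iK ⟨y, hy⟩, ⟨h3.symm, mem_univ _⟩, ?_⟩
  rw [← h1, ← h2, heq]

/-- Finitely many pairs of simplices are treated one after the other; separation over the earlier
pairs is an open condition and survives. -/
theorem HasHDD.exists_disjoint_on_finset [DecidableEq C] (hsub : Submetrizable X)
    (hX : HasHDD X m n k)
    (hpN : ∀ x, (pN x : C → ℝ) = pushforward φ x) (hpK : ∀ x, (pK x : C → ℝ) = pushforward ψ x)
    (hm : ∀ s ∈ N.faces, ((s.image φ).card : ℕ∞) ≤ m + 1) (hn : MapDimLE pN n)
    (hk : MapDimLE pK k) (S : Finset (Finset A × Finset B)) {𝒰 : Set (Set X)}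
    (h𝒰 : IsOpenCovering 𝒰) (f : C(realization N, X)) (g : C(realization K, X)) :
    ∃ (f' : C(realization N, X)) (g' : C(realization K, X)),
      UHomotopic 𝒰 f' f ∧ UHomotopic 𝒰 g' g ∧
      ∀ q ∈ S, q.1 ∈ N.faces → q.2 ∈ K.faces → q.1.image φ = q.2.image ψ →
        ∀ (x : realization N) (y : realization K), (x : A → ℝ) ∈ closedSimplex q.1 →
          (y : B → ℝ) ∈ closedSimplex q.2 → pN x = pK y → f' x ≠ g' y := by
  classical
  induction S using Finset.induction_on with
  | empty => exact ⟨f, g, .refl h𝒰 f, .refl h𝒰 g, by simp⟩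
  | insert q S _ ih =>
    obtain ⟨f₁, g₁, hf₁, hg₁, hS⟩ := ih
    by_cases hq : q.1 ∈ N.faces ∧ q.2 ∈ K.faces ∧ q.1.image φ = q.2.image ψ
    swap
    · refine ⟨f₁, g₁, hf₁, hg₁, fun q' hq' h1 h2 h3 => ?_⟩
      rcases Finset.mem_insert.1 hq' with rfl | hq'
      · exact absurd ⟨h1, h2, h3⟩ hq
      · exact hS q' hq' h1 h2 h3
    -- the pairs of points on which the maps have been separated already
    let Z : Set (realization N × realization K) := ⋃ q ∈ {q | q ∈ S ∧ q.1 ∈ N.faces ∧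
      q.2 ∈ K.faces ∧ q.1.image φ = q.2.image ψ}, {z | (z.1 : A → ℝ) ∈ closedSimplex q.1 ∧
        (z.2 : B → ℝ) ∈ closedSimplex q.2 ∧ pN z.1 = pK z.2}
    have hZ : IsCompact Z := by
      refine (toFinite _).isCompact_biUnion fun q _ => IsClosed.isCompact ?_
      refine ((isCompact_closedSimplex q.1).isClosed.preimage (by fun_prop)).inter
        (((isCompact_closedSimplex q.2).isClosed.preimage (by fun_prop)).inter ?_)
      have hφ := continuous_pushforward φ
      have hψ := continuous_pushforward ψ
      simp only [← Subtype.coe_inj, hpN, hpK]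
      exact isClosed_eq (by fun_prop) (by fun_prop)
    obtain ⟨𝒱, h𝒱, hne⟩ := hsub.exists_covering_ne hZ (f := f₁) (g := g₁) (by
      intro z hz
      simp only [Z, mem_iUnion] at hz
      obtain ⟨q, ⟨hqS, h1, h2, h3⟩, h4, h5, h6⟩ := hz
      exact hS q hqS h1 h2 h3 z.1 z.2 h4 h5 h6)
    obtain ⟨𝒱f, h𝒱f, hf⟩ := hf₁.exists_covering_trans h𝒰
    obtain ⟨𝒱g, h𝒱g, hg⟩ := hg₁.exists_covering_trans h𝒰
    obtain ⟨f₂, g₂, hf₂, hg₂, hd⟩ := hX.exists_disjoint_on_closedSimplex hpN hpK hn hk hq.1 hq.2.1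
      hq.2.2 (hm _ hq.1) (h𝒱.inter (h𝒱f.inter h𝒱g)) f₁ g₁
    refine ⟨f₂, g₂, hf _ hf₂.of_inter_right.of_inter_left, hg _ hg₂.of_inter_right.of_inter_right,
      fun q' hq' h1 h2 h3 x y hx hy hxy => ?_⟩
    rcases Finset.mem_insert.1 hq' with rfl | hq'
    · exact hd x y hx hy hxy
    · refine hne f₂ g₂ hf₂.of_inter_left hg₂.of_inter_left (x, y) ?_
      simp only [Z, mem_iUnion]
      exact ⟨q', ⟨hq', h1, h2, h3⟩, hx, hy, hxy⟩

/-- Two points with the same image lie in the interiors of simplices with the same image, so only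
such pairs of simplices matter. -/
theorem HasHDD.exists_disjoint_fibers (hsub : Submetrizable X) (hX : HasHDD X m n k)
    (hpN : IsSimplicialMap pN) (hpK : IsSimplicialMap pK) (hm : ComplexDimLE M m)
    (hn : MapDimLE pN n) (hk : MapDimLE pK k) {𝒰 : Set (Set X)}
    (h𝒰 : IsOpenCovering 𝒰) (f : C(realization N, X)) (g : C(realization K, X)) :
    ∃ (f' : C(realization N, X)) (g' : C(realization K, X)),
      UHomotopic 𝒰 f' f ∧ UHomotopic 𝒰 g' g ∧
      ∀ z : realization M, Disjoint (f' '' (pN ⁻¹' {z})) (g' '' (pK ⁻¹' {z})) := by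
  classical
  obtain ⟨φ, hφ, hφM⟩ := hpN.exists_vertexMap
  obtain ⟨ψ, hψ, -⟩ := hpK.exists_vertexMap
  obtain ⟨f', g', hf', hg', hd⟩ := hX.exists_disjoint_on_finset hsub hφ hψ
    (fun s hs => hm _ (hφM s hs)) hn hk Finset.univ h𝒰 f g
  refine ⟨f', g', hf', hg', fun z => disjoint_left.2 ?_⟩
  rintro _ ⟨x, hx, rfl⟩ ⟨y, hy, hxy⟩
  obtain ⟨s, -, hs⟩ := mem_realization.1 x.2
  obtain ⟨t, -, ht⟩ := mem_realization.1 y.2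
  have hpxy : pN x = pK y := hx.trans hy.symm
  refine hd (carrier (x : A → ℝ), carrier (y : B → ℝ)) (Finset.mem_univ _) (carrier_mem_faces x.2)
    (carrier_mem_faces y.2) ?_ x y (mem_closedSimplex_carrier hs) (mem_closedSimplex_carrier ht)
    hpxy hxy.symm
  rw [← carrier_pushforward φ hs, ← carrier_pushforward ψ ht, ← hφ, ← hψ, hpxy]

end GeneralPosition

/-! ### Simplicial maps given on vertices -/

section VertexMaps

variable {V W : Type*} [Fintype V] [Fintype W] [DecidableEq W]
  {K : AbstractSimplicialComplex V} {M : AbstractSimplicialComplex W}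

/-- The map of realizations induced by a map of vertices that carries faces to faces. -/
def simplicialMap (φ : V → W) (hφ : ∀ s ∈ K.faces, s.image φ ∈ M.faces) :
    realization K → realization M := fun x =>
  ⟨pushforward φ x, by
    obtain ⟨s, hs, hx⟩ := mem_realization.1 x.2
    exact mem_realization.2 ⟨_, hφ s hs, pushforward_mem_closedSimplex φ hx⟩⟩

theorem isSimplicialMap_simplicialMap (φ : V → W) (hφ : ∀ s ∈ K.faces, s.image φ ∈ M.faces) :
    IsSimplicialMap (simplicialMap φ hφ) where
  maps_onto s hs := by
    refine ⟨_, hφ s hs, ?_⟩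
    rw [← image_pushforward_closedSimplex]
    ext z
    constructor
    · rintro ⟨x, hx, rfl⟩
      exact ⟨x, hx, rfl⟩
    · rintro ⟨x, hx, rfl⟩
      exact ⟨⟨x, closedSimplex_subset_realization hs hx⟩, hx, rfl⟩
  linear s hs x y z _ _ a b _ _ _ hz := by
    simp only [simplicialMap, hz, map_add, map_smul]

/-- A convex subset of a polyhedron lies in a single simplex, namely the carrier of a point of the
subset with the largest possible carrier. -/
theorem exists_face_of_convex_subset {P : Set (V → ℝ)} (hP : Convex ℝ P) (hne : P.Nonempty)
    (hPK : P ⊆ realization K) : ∃ s ∈ K.faces, P ⊆ closedSimplex s := by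
  obtain ⟨s, ⟨⟨x, hx, rfl⟩, hmax⟩⟩ := (toFinite (carrier '' P)).exists_maximal (hne.image _)
  refine ⟨_, carrier_mem_faces (hPK hx), fun y hy => ?_⟩
  obtain ⟨t, -, hyt⟩ := mem_realization.1 (hPK hy)
  obtain ⟨s, -, hxs⟩ := mem_realization.1 (hPK hx)
  have hx0 := (mem_closedSimplex.1 hxs).1
  have hy0 := (mem_closedSimplex.1 hyt).1
  have hz := hP hx hy (show (0 : ℝ) ≤ 1 / 2 by norm_num) (show (0 : ℝ) ≤ 1 / 2 by norm_num)
    (by norm_num)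
  set z : V → ℝ := (1 / 2 : ℝ) • x + (1 / 2 : ℝ) • y with hzdef
  have hzv : ∀ v, z v = 1 / 2 * x v + 1 / 2 * y v := fun v => by simp [hzdef]
  have hxz : carrier x ⊆ carrier z := fun v hv => by
    rw [mem_carrier] at *
    have := (hx0 v).lt_of_ne' hv
    have := hy0 v
    rw [hzv]
    positivity
  have hyz : carrier y ⊆ carrier z := fun v hv => by
    rw [mem_carrier] at *
    have := (hy0 v).lt_of_ne' hv
    have := hx0 v
    rw [hzv]
    positivity
  exact closedSimplex_mono (hyz.trans (hmax ⟨z, hz, rfl⟩ hxz)) (mem_closedSimplex_carrier hyt)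

/-- A simplicial map that loses at most `n` vertices on each simplex has fibres of dimension at
most `n`. -/
theorem mapDimLE_simplicialMap (φ : V → W) (hφ : ∀ s ∈ K.faces, s.image φ ∈ M.faces) {n : ℕ∞}
    (hn : ∀ s ∈ K.faces, (s.card : ℕ∞) ≤ (s.image φ).card + n) :
    MapDimLE (simplicialMap φ hφ) n := by
  classical
  intro z t ht htz
  rcases t.eq_empty_or_nonempty with rfl | htne
  · simp
  have hmem : ∀ x ∈ convexHull ℝ (t : Set (V → ℝ)), x ∈ realization K ∧ pushforward φ x = z := by
    intro x hx
    obtain ⟨y, hy, rfl⟩ := htz hx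
    exact ⟨y.2, congrArg Subtype.val hy⟩
  obtain ⟨s, hs, hts⟩ := exists_face_of_convex_subset (convex_convexHull ℝ (t : Set (V → ℝ)))
    (by simpa using htne) fun x hx => (hmem x hx).1
  obtain ⟨R, hRs, hR, himg⟩ :=
    Finset.exists_subset_injOn_image_eq_of_surjOn (f := φ) s (s.image φ) (by
      rw [Finset.coe_image]
      exact surjOn_image φ s)
  have hRs : R ⊆ s := hRs
  -- projecting to the coordinates outside of `R` keeps the points affinely independent
  let Q : (V → ℝ) →ₗ[ℝ] ((s \ R : Finset V) → ℝ) := LinearMap.funLeft ℝ ℝ Subtype.val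
  have hind : AffineIndependent ℝ fun x : t => Q x := by
    rw [affineIndependent_iff] at ht ⊢
    intro F w hw0 hw
    refine ht F w hw0 ?_
    have hsub : ∀ x : t, (x : V → ℝ) ∈ convexHull ℝ (t : Set (V → ℝ)) := fun x =>
      subset_convexHull ℝ _ x.2
    refine eq_of_pushforward_eq (φ := φ) (s := s) hR (fun v hv => ?_) (fun v _ => rfl) ?_
      fun v hv => ?_
    · rw [Finset.sum_apply]
      refine Finset.sum_eq_zero fun x _ => ?_
      simp [(hts (hsub x)).2 v hv]
    · simp only [map_sum, map_smul, (hmem _ (hsub _)).2, ← Finset.sum_smul, hw0, zero_smul, map_zero]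
    · have := congrFun hw ⟨v, hv⟩
      simpa [Q, Finset.sum_apply, LinearMap.funLeft_apply] using this
  have h1 := hind.card_le_finrank_succ
  have h2 := Submodule.finrank_le (vectorSpan ℝ (range fun x : t => Q x))
  rw [Module.finrank_fintype_fun_eq_card, Fintype.card_coe] at h2
  rw [Fintype.card_coe] at h1
  have h3 : (s \ R).card + (s.image φ).card = s.card := by
    rw [← himg, Finset.card_image_of_injOn hR, Finset.card_sdiff_add_card_eq_card hRs]
  have h4 : ((s \ R).card : ℕ∞) ≤ n := by
    have := hn s hs
    rw [← h3, Nat.cast_add, add_comm] at this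
    exact (ENat.add_le_add_iff_left (ENat.natCast_ne_top _)).1 this
  calc (t.card : ℕ∞) ≤ ((s \ R).card + 1 : ℕ) := by exact_mod_cast h1.trans (by omega)
    _ ≤ n + 1 := by push_cast; gcongr

end VertexMaps

/-! ### The triangulation of a cube by chains -/

section OrderComplex

variable {H A : Type*} [Fintype H]

/-- The order complex of the poset of subsets of `H`: its simplices are the chains. The vertices
are named by a type `A`, which may live in any universe. -/
def chainComplex (e : A → Finset H) : AbstractSimplicialComplex A where
  faces := {s | s.Nonempty ∧ ∀ a ∈ s, ∀ b ∈ s, e a ⊆ e b ∨ e b ⊆ e a}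
  isRelLowerSet_faces := fun _ hs => ⟨hs.1, fun _ hts ht =>
    ⟨ht, fun a ha b hb => hs.2 a (hts ha) b (hts hb)⟩⟩
  singleton_mem v := ⟨by simp, by simp⟩

theorem card_le_of_mem_chainComplex {e : A → Finset H} (he : e.Injective) {s : Finset A}
    (hs : s ∈ (chainComplex e).faces) : s.card ≤ Fintype.card H + 1 := by
  rw [← Finset.card_range (Fintype.card H + 1)]
  refine Finset.card_le_card_of_injOn (fun a => (e a).card) ?_ ?_
  · intro a _
    simpa [Nat.lt_succ_iff] using Finset.card_le_univ (e a)
  · intro a ha b hb hab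
    rcases hs.2 a ha b hb with h | h
    · exact he (Finset.eq_of_subset_of_card_le h hab.ge)
    · exact he (Finset.eq_of_subset_of_card_le h hab.le).symm

/-- The indices at which the coordinate of a point `x` of the cube exceeds the level `t`. -/
noncomputable def superlevel (x : H → unitInterval) (t : ℝ) : Finset H := by
  classical exact Finset.univ.filter fun i => t < x i

@[simp] theorem mem_superlevel {x : H → unitInterval} {t : ℝ} {i : H} :
    i ∈ superlevel x t ↔ t < x i := by
  simp [superlevel]

theorem superlevel_anti (x : H → unitInterval) {t t' : ℝ} (h : t ≤ t') :
    superlevel x t' ⊆ superlevel x t := fun i hi => by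
  rw [mem_superlevel] at *
  exact h.trans_lt hi

variable [DecidableEq H]

/-- The barycentric coordinate at the vertex `S` of a point of the cube, with respect to the
triangulation of the cube by the chains of subsets of `H`. It is the length of the set of levels
`t` at which the superlevel set is `S`. -/
noncomputable def cubeCoord (x : H → unitInterval) (S : Finset H) : ℝ :=
  max 0 ((S.inf x : unitInterval) - (Sᶜ.sup x : unitInterval) : ℝ)

theorem continuous_cubeCoord (S : Finset H) :
    Continuous fun x : H → unitInterval => cubeCoord x S := by
  have h1 : Continuous fun x : H → unitInterval => S.inf x :=
    Continuous.finset_inf_apply fun i _ => continuous_apply i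
  have h2 : Continuous fun x : H → unitInterval => Sᶜ.sup x :=
    Continuous.finset_sup_apply fun i _ => continuous_apply i
  exact continuous_const.max ((continuous_subtype_val.comp h1).sub (continuous_subtype_val.comp h2))

theorem setOf_superlevel_eq (x : H → unitInterval) (S : Finset H) :
    {t ∈ Ico (0 : ℝ) 1 | superlevel x t = S} =
      Ico ((Sᶜ.sup x : unitInterval) : ℝ) (S.inf x : unitInterval) := by
  ext t
  have hS : superlevel x t = S ↔ (∀ i ∈ S, t < x i) ∧ ∀ i ∉ S, x i ≤ t := by
    rw [Finset.ext_iff]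
    simp only [mem_superlevel]
    constructor
    · exact fun h => ⟨fun i hi => (h i).2 hi, fun i hi => not_lt.1 fun h' => hi ((h i).1 h')⟩
    · exact fun h i => ⟨fun hi => by_contra fun hn => not_lt.2 (h.2 i hn) hi, h.1 i⟩
  rw [mem_ofPred_eq, hS]
  constructor
  · rintro ⟨⟨h0, h1⟩, h2, h3⟩
    have h4 : Sᶜ.sup x ≤ (⟨t, h0, h1.le⟩ : unitInterval) :=
      Finset.sup_le fun i hi => h3 i (Finset.mem_compl.1 hi)
    have h5 : (⟨t, h0, h1.le⟩ : unitInterval) < S.inf x :=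
      (Finset.lt_inf_iff (show (⟨t, h0, h1.le⟩ : unitInterval) < 1 from h1)).2 fun i hi => h2 i hi
    exact ⟨h4, h5⟩
  · rintro ⟨h0, h1⟩
    refine ⟨⟨(Sᶜ.sup x).2.1.trans h0, h1.trans_le (S.inf x).2.2⟩, fun i hi => ?_, fun i hi => ?_⟩
    · exact h1.trans_le (Finset.inf_le hi : S.inf x ≤ x i)
    · exact le_trans (Finset.le_sup (Finset.mem_compl.2 hi) : x i ≤ Sᶜ.sup x) h0

open MeasureTheory in
theorem sum_cubeCoord (x : H → unitInterval) (F : Finset (Finset H)) :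
    ∑ S ∈ F, cubeCoord x S = volume.real {t ∈ Ico (0 : ℝ) 1 | superlevel x t ∈ F} := by
  have h : {t ∈ Ico (0 : ℝ) 1 | superlevel x t ∈ F} =
      ⋃ S ∈ F, {t ∈ Ico (0 : ℝ) 1 | superlevel x t = S} := by
    ext t; simp
  rw [h, measureReal_biUnion_finset ?_ ?_ ?_]
  · refine Finset.sum_congr rfl fun S _ => ?_
    rw [setOf_superlevel_eq, Measure.real, Real.volume_Ico, ENNReal.toReal_ofReal', cubeCoord,
      max_comm]
  · intro S _ T _ hST
    refine disjoint_left.2 ?_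
    rintro t ⟨-, rfl⟩ ⟨-, rfl⟩
    exact hST rfl
  · intro S _
    rw [setOf_superlevel_eq]
    exact measurableSet_Ico
  · intro S _
    rw [setOf_superlevel_eq]
    simp

theorem exists_superlevel_eq {x : H → unitInterval} {S : Finset H} (h : cubeCoord x S ≠ 0) :
    ∃ t, superlevel x t = S := by
  have h1 := sum_cubeCoord x {S}
  rw [Finset.sum_singleton] at h1
  by_contra hne
  refine h (h1.trans ?_)
  have : {t ∈ Ico (0 : ℝ) 1 | superlevel x t ∈ ({S} : Finset (Finset H))} = ∅ := by
    refine eq_empty_of_forall_notMem fun t ht => hne ⟨t, ?_⟩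
    simpa using ht.2
  rw [this, MeasureTheory.measureReal_empty]

theorem sum_cubeCoord_univ (x : H → unitInterval) : ∑ S, cubeCoord x S = 1 := by
  have : {t ∈ Ico (0 : ℝ) 1 | superlevel x t ∈ Finset.univ} = Ico 0 1 := by ext; simp
  rw [sum_cubeCoord, this]
  simp

theorem sum_cubeCoord_mem (x : H → unitInterval) (i : H) :
    ∑ S with i ∈ S, cubeCoord x S = x i := by
  have : {t ∈ Ico (0 : ℝ) 1 | superlevel x t ∈ Finset.univ.filter fun S => i ∈ S} =
      Ico 0 (x i : ℝ) := by
    ext t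
    have := (x i).2.2
    simp only [Finset.mem_filter, Finset.mem_univ, true_and, mem_superlevel, mem_ofPred_eq, mem_Ico]
    constructor
    · exact fun h => ⟨h.1.1, h.2⟩
    · exact fun h => ⟨⟨h.1, h.2.trans_le this⟩, h.2⟩
  rw [sum_cubeCoord, this]
  simp [(x i).2.1]

/-- Forgetting coordinates of the point amounts to summing barycentric coordinates over the
vertices with the same trace, as both sides measure the same set of levels. -/
theorem sum_cubeCoord_toLeft {I J : Type*} [Fintype I] [Fintype J] [DecidableEq I] [DecidableEq J]
    (x : I ⊕ J → unitInterval) (T : Finset I) :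
    ∑ S with S.toLeft = T, cubeCoord x S = cubeCoord (x ∘ Sum.inl) T := by
  have h := sum_cubeCoord (x ∘ Sum.inl) {T}
  rw [Finset.sum_singleton] at h
  rw [h, sum_cubeCoord]
  have : ∀ t, (superlevel x t).toLeft = superlevel (x ∘ Sum.inl) t := fun t => by
    ext i; simp
  simp [this]

variable [Fintype A]

/-- The point of the chain complex that corresponds to a point of the cube. -/
noncomputable def cubeToComplex (e : A ≃ Finset H) :
    C(H → unitInterval, realization (chainComplex e)) where
  toFun x := ⟨fun a => cubeCoord x (e a), mem_realization_of_carrier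
    (fun _ => le_max_left _ _)
    (by rw [e.sum_comp fun S => cubeCoord x S, sum_cubeCoord_univ])
    ⟨by
      by_contra h
      have h0 : ∀ a, cubeCoord x (e a) = 0 := fun a => by
        by_contra ha
        exact h ⟨a, mem_carrier.2 ha⟩
      have := e.sum_comp fun S => cubeCoord x S
      simp [h0, sum_cubeCoord_univ] at this,
    fun a ha b hb => by
      obtain ⟨t, ht⟩ := exists_superlevel_eq (x := x) (S := e a)
        (mem_carrier (x := fun a => cubeCoord x (e a)).1 ha)
      obtain ⟨t', ht'⟩ := exists_superlevel_eq (x := x) (S := e b)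
        (mem_carrier (x := fun a => cubeCoord x (e a)).1 hb)
      rw [← ht, ← ht']
      rcases le_total t t' with h | h
      · exact Or.inr (superlevel_anti x h)
      · exact Or.inl (superlevel_anti x h)⟩⟩
  continuous_toFun := Continuous.subtype_mk (continuous_pi fun a => continuous_cubeCoord (e a)) _

/-- The map that is affine on simplices and sends the vertex `S` to the indicator function of `S`.
The projection to `[0,1]` has no effect and serves to avoid a proof of membership. -/
noncomputable def complexToCube (e : A ≃ Finset H) :
    C(realization (chainComplex e), H → unitInterval) where
  toFun w i := projIcc 0 1 zero_le_one (∑ a with i ∈ e a, (w : A → ℝ) a)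
  continuous_toFun := continuous_pi fun i => continuous_projIcc.comp (by fun_prop)

theorem complexToCube_cubeToComplex (e : A ≃ Finset H) (x : H → unitInterval) :
    complexToCube e (cubeToComplex e x) = x := by
  ext i
  have : ∑ a with i ∈ e a, cubeCoord x (e a) = x i := by
    rw [← sum_cubeCoord_mem, Finset.sum_filter, Finset.sum_filter]
    exact e.sum_comp fun S => if i ∈ S then cubeCoord x S else 0
  simp [complexToCube, cubeToComplex, this]

end OrderComplex

/-! ### Triangulated projections of cubes -/

section CubeProjections

variable {I J A C : Type*} [DecidableEq C]

/-- The map of vertices inducing the projection of the triangulated cube `[0,1]^I × [0,1]^J` to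
`[0,1]^I`. -/
def vertexProjection (e : A ≃ Finset (I ⊕ J)) (c : C ≃ Finset I) (a : A) : C :=
  c.symm (e a).toLeft

theorem image_vertexProjection_mem_faces (e : A ≃ Finset (I ⊕ J)) (c : C ≃ Finset I) :
    ∀ s ∈ (chainComplex e).faces, s.image (vertexProjection e c) ∈ (chainComplex c).faces := by
  rintro s ⟨hne, hs⟩
  refine ⟨hne.image _, fun x hx y hy => ?_⟩
  obtain ⟨a, ha, rfl⟩ := Finset.mem_image.1 hx
  obtain ⟨b, hb, rfl⟩ := Finset.mem_image.1 hy
  simp only [vertexProjection, Equiv.apply_symm_apply]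
  exact (hs a ha b hb).imp (fun h => Finset.toLeft_monotone h) fun h => Finset.toLeft_monotone h

/-- The fibres of the triangulated projection are at most `|J|`-dimensional: in a chain of subsets
of `I ⊕ J`, all but `|J|` vertices have different traces on `I`. -/
theorem card_le_card_image_vertexProjection [Fintype J] (e : A ≃ Finset (I ⊕ J)) (c : C ≃ Finset I)
    {s : Finset A} (hs : s ∈ (chainComplex e).faces) :
    s.card ≤ (s.image (vertexProjection e c)).card + Fintype.card J := by
  classical
  have hφ : ∀ a b, vertexProjection e c a = vertexProjection e c b ↔
      (e a).toLeft = (e b).toLeft := fun a b => by simp [vertexProjection]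
  -- every step of the chain that is not visible in `I` adds elements of `J`
  let T := s.filter fun a => ∃ b ∈ s, (e a).toLeft = (e b).toLeft ∧ e b ⊂ e a
  have hr : ∀ a b, (e a).toLeft = (e b).toLeft → e b ⊂ e a →
      (e b).toRight.card < (e a).toRight.card := fun a b h hab => by
    have h1 := Finset.card_lt_card hab
    rw [← Finset.card_toLeft_add_card_toRight (u := e a),
      ← Finset.card_toLeft_add_card_toRight (u := e b), h] at h1
    omega
  have hT : T.card ≤ Fintype.card J := by
    have hIcc : Fintype.card J = (Finset.Icc 1 (Fintype.card J)).card := by simp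
    rw [hIcc]
    refine Finset.card_le_card_of_injOn (fun a => (e a).toRight.card) ?_ ?_
    · intro a ha
      obtain ⟨-, b, -, hab, hba⟩ := Finset.mem_filter.1 ha
      have := hr a b hab hba
      simp only [Finset.coe_Icc, mem_Icc]
      exact ⟨by omega, Finset.card_le_univ _⟩
    · -- if `a ⊂ b` had the same trace on `J`, then an element of the chain just below `b` with the
      -- same trace on `I` as `b` could lie neither below nor above `a`
      have key : ∀ a ∈ T, ∀ b ∈ T, e a ⊆ e b → (e a).toRight.card = (e b).toRight.card → a = b := by
        intro a ha b hb hab hcard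
        by_contra hne
        obtain ⟨has, -⟩ := Finset.mem_filter.1 ha
        obtain ⟨-, b', hb's, hbb', hb'b⟩ := Finset.mem_filter.1 hb
        have hlt := hr b b' hbb' hb'b
        have hright : (e a).toRight = (e b).toRight :=
          Finset.eq_of_subset_of_card_le (Finset.toRight_monotone hab) hcard.ge
        rcases hs.2 a has b' hb's with h | h
        · have := Finset.card_le_card (Finset.toRight_monotone h)
          omega
        · refine hne (e.injective ?_)
          have h2 : (e b).toLeft ⊆ (e a).toLeft := hbb' ▸ Finset.toLeft_monotone h
          have h3 := (Finset.toLeft_monotone hab).antisymm h2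
          rw [← Finset.toLeft_disjSum_toRight (u := e a), h3, hright,
            Finset.toLeft_disjSum_toRight]
      intro a ha b hb hab
      rcases hs.2 a (Finset.mem_filter.1 ha).1 b (Finset.mem_filter.1 hb).1 with h | h
      · exact key a ha b hb h hab
      · exact (key b hb a ha h hab.symm).symm
  have hinj : ((s \ T).image (vertexProjection e c)).card = (s \ T).card := by
    refine Finset.card_image_of_injOn ?_
    intro a ha b hb hab
    rw [hφ] at hab
    obtain ⟨has, haT⟩ := Finset.mem_sdiff.1 ha
    obtain ⟨hbs, hbT⟩ := Finset.mem_sdiff.1 hb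
    by_contra hne
    have hne' : e a ≠ e b := fun h => hne (e.injective h)
    rcases hs.2 a has b hbs with h | h
    · exact hbT (Finset.mem_filter.2 ⟨hbs, a, has, hab.symm, h.ssubset_of_ne hne'⟩)
    · exact haT (Finset.mem_filter.2 ⟨has, b, hbs, hab, h.ssubset_of_ne hne'.symm⟩)
  have h1 := Finset.card_le_card (Finset.image_subset_image (f := vertexProjection e c)
    (Finset.sdiff_subset (s := s) (t := T)))
  have hTs : T ⊆ s := Finset.filter_subset _ s
  have h2 := Finset.card_sdiff_add_card_eq_card hTs
  omega

/-- The triangulations of the cubes `[0,1]^I × [0,1]^J` and `[0,1]^I` commute with the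
projections. -/
theorem simplicialMap_cubeToComplex [Fintype I] [Fintype J] [DecidableEq I] [DecidableEq J]
    [Fintype A] [Fintype C] (e : A ≃ Finset (I ⊕ J)) (c : C ≃ Finset I)
    (x : I ⊕ J → unitInterval) :
    simplicialMap (vertexProjection e c) (image_vertexProjection_mem_faces e c)
      (cubeToComplex e x) = cubeToComplex c (x ∘ Sum.inl) := by
  refine Subtype.ext (funext fun b => ?_)
  have := sum_cubeCoord_toLeft x (c b)
  simp only [simplicialMap, cubeToComplex, ContinuousMap.coe_mk, pushforward_apply]
  rw [← this, Finset.sum_filter, Finset.sum_filter, ← e.sum_comp]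
  refine Finset.sum_congr rfl fun a _ => ?_
  simp only [vertexProjection, Equiv.symm_apply_eq]

end CubeProjections

section FiniteCubes

universe u v w x

/-- The separation property for simplicial maps gives the one for the projections of
finite-dimensional cubes, because these projections can be triangulated. The vertices of the
triangulations are lifted to the universes of the hypothesis. -/
theorem exists_disjoint_finite_cubes {X : Type u} [TopologicalSpace X] {m n k : ℕ∞}
    (h : ∀ (A : Type v) (B : Type w) (C : Type x) [Fintype A] [Fintype B] [Fintype C]
        (N : AbstractSimplicialComplex A) (K : AbstractSimplicialComplex B)
        (M : AbstractSimplicialComplex C)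
        (pN : realization N → realization M) (pK : realization K → realization M),
        IsSimplicialMap pN → IsSimplicialMap pK →
        ComplexDimLE M m → MapDimLE pN n → MapDimLE pK k →
        ∀ 𝒰 : Set (Set X), IsOpenCovering 𝒰 →
        ∀ (f : C(realization N, X)) (g : C(realization K, X)),
          ∃ (f' : C(realization N, X)) (g' : C(realization K, X)),
            UHomotopic 𝒰 f' f ∧ UHomotopic 𝒰 g' g ∧
            ∀ z : realization M, Disjoint (f' '' (pN ⁻¹' {z})) (g' '' (pK ⁻¹' {z})))
    {I J L : Type} [Fintype I] [Fintype J] [Fintype L] (hI : (Fintype.card I : ℕ∞) ≤ m)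
    (hJ : (Fintype.card J : ℕ∞) ≤ n) (hL : (Fintype.card L : ℕ∞) ≤ k) {𝒰 : Set (Set X)}
    (h𝒰 : IsOpenCovering 𝒰) (f : C((I → unitInterval) × (J → unitInterval), X))
    (g : C((I → unitInterval) × (L → unitInterval), X)) :
    ∃ (f' : C((I → unitInterval) × (J → unitInterval), X))
      (g' : C((I → unitInterval) × (L → unitInterval), X)),
      UHomotopic 𝒰 f' f ∧ UHomotopic 𝒰 g' g ∧ ∀ z y y', f' (z, y) ≠ g' (z, y') := by
  classical
  let eN : ULift.{v} (Finset (I ⊕ J)) ≃ Finset (I ⊕ J) := Equiv.ulift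
  let eK : ULift.{w} (Finset (I ⊕ L)) ≃ Finset (I ⊕ L) := Equiv.ulift
  let eM : ULift.{x} (Finset I) ≃ Finset I := Equiv.ulift
  have hM : ComplexDimLE (chainComplex eM) m := fun s hs => by
    have : (s.card : ℕ∞) ≤ (Fintype.card I + 1 : ℕ) := by
      exact_mod_cast card_le_of_mem_chainComplex eM.injective hs
    refine this.trans ?_
    push_cast
    gcongr
  have hn : MapDimLE (simplicialMap _ (image_vertexProjection_mem_faces eN eM)) n :=
    mapDimLE_simplicialMap _ _ fun s hs =>
      (Nat.cast_le.2 (card_le_card_image_vertexProjection eN eM hs)).trans (by push_cast; gcongr)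
  have hk : MapDimLE (simplicialMap _ (image_vertexProjection_mem_faces eK eM)) k :=
    mapDimLE_simplicialMap _ _ fun s hs =>
      (Nat.cast_le.2 (card_le_card_image_vertexProjection eK eM hs)).trans (by push_cast; gcongr)
  -- the cubes, with the two factors merged
  let pN : C(I ⊕ J → unitInterval, (I → unitInterval) × (J → unitInterval)) :=
    ⟨fun x => (x ∘ Sum.inl, x ∘ Sum.inr), by fun_prop⟩
  let pK : C(I ⊕ L → unitInterval, (I → unitInterval) × (L → unitInterval)) :=
    ⟨fun x => (x ∘ Sum.inl, x ∘ Sum.inr), by fun_prop⟩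
  let sN : C((I → unitInterval) × (J → unitInterval), I ⊕ J → unitInterval) :=
    ⟨fun x => Sum.elim x.1 x.2, continuous_pi (by rintro (i | j) <;> simp <;> fun_prop)⟩
  let sK : C((I → unitInterval) × (L → unitInterval), I ⊕ L → unitInterval) :=
    ⟨fun x => Sum.elim x.1 x.2, continuous_pi (by rintro (i | j) <;> simp <;> fun_prop)⟩
  obtain ⟨f', g', hf', hg', hd⟩ := h _ _ _ _ _ _ _ _
    (isSimplicialMap_simplicialMap _ (image_vertexProjection_mem_faces eN eM))
    (isSimplicialMap_simplicialMap _ (image_vertexProjection_mem_faces eK eM)) hM hn hk 𝒰 h𝒰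
    ((f.comp pN).comp (complexToCube eN)) ((g.comp pK).comp (complexToCube eK))
  refine ⟨(f'.comp (cubeToComplex eN)).comp sN, (g'.comp (cubeToComplex eK)).comp sK, ?_, ?_, ?_⟩
  · convert (hf'.comp_right (cubeToComplex eN)).comp_right sN using 1
    ext x
    simp [complexToCube_cubeToComplex, pN, sN]
  · convert (hg'.comp_right (cubeToComplex eK)).comp_right sK using 1
    ext x
    simp [complexToCube_cubeToComplex, pK, sK]
  · intro z y y' heq
    refine disjoint_left.1 (hd (cubeToComplex eM z)) ⟨cubeToComplex eN (sN (z, y)), ?_, rfl⟩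
      ⟨cubeToComplex eK (sK (z, y')), ?_, heq.symm⟩
    · exact simplicialMap_cubeToComplex eN eM _
    · exact simplicialMap_cubeToComplex eK eM _

end FiniteCubes

/-! ### Reduction to finite-dimensional cubes -/

section Truncation

/-- The deformation of the cube that multiplies the coordinate with index `i` by
`max 0 (1 - u * i)`. It starts at the identity, and every later stage kills all but finitely many
coordinates. -/
noncomputable def shrink (m : ℕ∞) : C(unitInterval × Cube m, Cube m) where
  toFun z i := z.2 i * projIcc 0 1 zero_le_one (1 - z.1 * (i : ℕ) : ℝ)
  continuous_toFun := continuous_pi fun i =>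
    Continuous.mul (by fun_prop) (continuous_projIcc.comp (by fun_prop))

theorem shrink_zero (m : ℕ∞) (x : Cube m) : shrink m (0, x) = x := by
  ext i
  simp [shrink]

/-- For `u > 0` the map `shrink m (u, ·)` factors through a finite-dimensional cube. -/
theorem exists_factor_shrink (m : ℕ∞) {u : unitInterval} (hu : 0 < u) :
    ∃ (I : Type) (_ : Fintype I) (q : C(Cube m, I → unitInterval)) (e : C(I → unitInterval, Cube m)),
      (Fintype.card I : ℕ∞) ≤ m ∧ ∀ x, e (q x) = shrink m (u, x) := by
  have hu0 : (0 : ℝ) < u := hu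
  obtain ⟨d, hd⟩ := exists_nat_ge (1 / (u : ℝ))
  let I := {i : {i : ℕ // (i : ℕ∞) < m} // i.1 < d}
  have : Finite I := Finite.of_injective (fun i : I => (⟨i.1.1, i.2⟩ : Fin d)) fun i j hij => by
    exact Subtype.ext (Subtype.ext (Fin.ext_iff.1 hij))
  have : Fintype I := Fintype.ofFinite I
  refine ⟨I, this, ⟨fun x i => shrink m (u, x) i.1, by fun_prop⟩,
    ⟨fun y i => if h : i.1 < d then y ⟨i, h⟩ else 0, ?_⟩, ?_, fun x => ?_⟩
  · refine continuous_pi fun i => ?_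
    by_cases h : i.1 < d
    · simp only [h, dif_pos]; fun_prop
    · simp only [h, dif_neg, not_false_eq_true]; fun_prop
  · induction m with
    | top => exact le_top
    | coe M =>
      have := Fintype.card_le_of_injective
        (fun i : I => (⟨i.1.1, by exact_mod_cast i.1.2⟩ : Fin M)) fun i j hij => by
          exact Subtype.ext (Subtype.ext (Fin.ext_iff.1 hij))
      rw [Fintype.card_fin] at this
      exact_mod_cast this
  · ext i
    by_cases h : i.1 < d
    · simp [h]
    · have hi : (d : ℝ) ≤ (i : ℕ) := by exact_mod_cast not_lt.1 h
      have h1 : (1 - u * (i : ℕ) : ℝ) ≤ 0 := by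
        have := (div_le_iff₀ hu0).1 (hd.trans hi)
        linarith
      simp [h, shrink, projIcc_of_le_left zero_le_one h1]

/-- It is enough to separate maps of finite-dimensional cubes, since up to a small homotopy every
map of a cube depends on finitely many coordinates only. -/
theorem hasHDD_of_finite_cubes {X : Type*} [TopologicalSpace X] [T2Space X] {m n k : ℕ∞}
    (h : ∀ (I J L : Type) [Fintype I] [Fintype J] [Fintype L], (Fintype.card I : ℕ∞) ≤ m →
      (Fintype.card J : ℕ∞) ≤ n → (Fintype.card L : ℕ∞) ≤ k →
      ∀ 𝒰 : Set (Set X), IsOpenCovering 𝒰 →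
      ∀ (f : C((I → unitInterval) × (J → unitInterval), X))
        (g : C((I → unitInterval) × (L → unitInterval), X)),
        ∃ (f' : C((I → unitInterval) × (J → unitInterval), X))
          (g' : C((I → unitInterval) × (L → unitInterval), X)),
          UHomotopic 𝒰 f' f ∧ UHomotopic 𝒰 g' g ∧ ∀ z y y', f' (z, y) ≠ g' (z, y')) :
    HasHDD X m n k := by
  have hshrink : ∀ {n : ℕ∞} {𝒰 : Set (Set X)}, IsOpenCovering 𝒰 → ∀ f : C(Cube m × Cube n, X),
      ∃ c : unitInterval, 0 < c ∧ ∀ c' ≤ c, UHomotopic 𝒰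
        ⟨fun x => f (shrink m (c', x.1), shrink n (c', x.2)), by fun_prop⟩ f := by
    intro n 𝒰 h𝒰 f
    obtain ⟨c, hc, hcU⟩ := exists_forall_le_mem_covering h𝒰
      (K := Cube m × Cube n) ⟨fun z => f (shrink m (z.1, z.2.1), shrink n (z.1, z.2.2)),
        by fun_prop⟩
    refine ⟨c, hc, fun c' hc' => ⟨⟨⟨fun z => f (shrink m (unitInterval.symm z.1 * c', z.2.1),
      shrink n (unitInterval.symm z.1 * c', z.2.2)), by fun_prop⟩, ?_, ?_⟩, fun x => ?_⟩⟩
    · intro x; simp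
    · intro x; simp [shrink_zero]
    · obtain ⟨U, hU, hx⟩ := hcU c' hc' x
      exact ⟨U, hU, fun t => hx _ unitInterval.mul_le_right⟩
  intro 𝒰 h𝒰 f g
  obtain ⟨c₁, hc₁, hf⟩ := hshrink h𝒰 f
  obtain ⟨c₂, hc₂, hg⟩ := hshrink h𝒰 g
  have hc : 0 < min c₁ c₂ := lt_min hc₁ hc₂
  obtain ⟨I, _, qm, em, hI, hm⟩ := exists_factor_shrink m hc
  obtain ⟨J, _, qn, en, hJ, hn⟩ := exists_factor_shrink n hc
  obtain ⟨L, _, qk, ek, hL, hk⟩ := exists_factor_shrink k hc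
  obtain ⟨𝒱f, h𝒱f, hVf⟩ := (hf _ (min_le_left c₁ c₂)).exists_covering_trans h𝒰
  obtain ⟨𝒱g, h𝒱g, hVg⟩ := (hg _ (min_le_right c₁ c₂)).exists_covering_trans h𝒰
  obtain ⟨f', g', hf', hg', hd⟩ := h I J L hI hJ hL _ (h𝒱f.inter h𝒱g) (f.comp (em.prodMap en))
    (g.comp (em.prodMap ek))
  refine ⟨f'.comp (qm.prodMap qn), g'.comp (qm.prodMap qk), hVf _ ?_, hVg _ ?_, fun z => ?_⟩
  · convert hf'.of_inter_left.comp_right (qm.prodMap qn) using 1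
    ext x
    simp [hm, hn, Prod.map]
  · convert hg'.of_inter_right.comp_right (qm.prodMap qk) using 1
    ext x
    simp [hm, hk, Prod.map]
  · refine disjoint_left.2 ?_
    rintro _ ⟨⟨z₁, y⟩, ⟨rfl, -⟩, rfl⟩ ⟨⟨z₂, y'⟩, ⟨hz, -⟩, heq⟩
    obtain rfl : z₂ = z₁ := hz
    exact hd (qm z₂) (qn y) (qk y') heq.symm

end Truncation

/-! ### The characterization -/

theorem mainTheorem5 {X : Type*} [TopologicalSpace X] [T35Space X] (hX : Submetrizable X)
    (m n k : ℕ∞) :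
    HasHDD X m n k ↔
      ∀ (A B C : Type*) [Fintype A] [Fintype B] [Fintype C]
        (N : AbstractSimplicialComplex A) (K : AbstractSimplicialComplex B)
        (M : AbstractSimplicialComplex C)
        (pN : realization N → realization M) (pK : realization K → realization M),
        IsSimplicialMap pN → IsSimplicialMap pK →
        ComplexDimLE M m → MapDimLE pN n → MapDimLE pK k →
        ∀ 𝒰 : Set (Set X), IsOpenCovering 𝒰 →
        ∀ (f : C(realization N, X)) (g : C(realization K, X)),
          ∃ (f' : C(realization N, X)) (g' : C(realization K, X)),
            UHomotopic 𝒰 f' f ∧ UHomotopic 𝒰 g' g ∧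
            ∀ z : realization M, Disjoint (f' '' (pN ⁻¹' {z})) (g' '' (pK ⁻¹' {z})) := by
  constructor
  · intro h A B C _ _ _ N K M pN pK hpN hpK hM hn hk 𝒰 h𝒰 f g
    exact h.exists_disjoint_fibers hX hpN hpK hM hn hk h𝒰 f g
  · intro h
    exact hasHDD_of_finite_cubes fun I J L _ _ _ hI hJ hL 𝒰 h𝒰 f g =>
      exists_disjoint_finite_cubes h hI hJ hL h𝒰 f g
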